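/- **Theorem 4.1 (Implicit regularization for discrete-time mixed $\mathcal H_2/\mathcal H_\infty$ design).** Let $A\in\mathbb R^{m\times m}$, $B\in\mathbb R^{m\times d}$, $C\in\mathbb R^{l\times m}$, $D\in\mathbb R^{m\times n}$, let $R\in\mathbb R^{d\times d}$ be symmetric positive definite, and let $\gamma>0$. Write $\rho$ for the spectral radius and $\|\cdot\|$ for the operator norm of a matrix (induced by the Euclidean norms). For $K\in\mathbb R^{d\times m}$ let $$\mathcal T(K)(z)=(C^\top C+K^\top RK)^{1/2}\,\bigl(zI-(A-BK)\bigr)^{-1}D,\qquad \|\mathcal T(K)\|_\infty=\sup_{\theta\in[0,2\pi)}\sigma_{\max}\bigl(\mathcal T(K)(e^{j\theta})\bigr),$$ $$\mathcal K=\{K\in\mathbb R^{d\times m} : \rho(A-BK)<1 \text{ and } \|\mathcal T(K)\|_\infty<\gamma\}.$$ For a symmetric $P\in\mathbb R^{m\times m}$ put $\tilde P=P+PD(\gamma^2I-D^\top PD)^{-1}D^\top P$. A *stabilizing Riccati solution for* $K$ is a symmetric matrix $P\ge 0$ such that $$(A-BK)^\top\tilde P(A-BK)+C^\top C+K^\top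 RK-P=0,$$ $$I-\gamma^{-2}D^\top PD>0,\qquad \rho\bigl((I-\gamma^{-2}PDD^\top)^{-\top}(A-BK)\bigr)<1 .$$ Let $K\in\mathcal K$. Then there is exactly one stabilizing Riccati solution $P_K$ for $K$. Put $E_K=(R+B^\top\tilde P_KB)K-B^\top\tilde P_KA$, and let $\eta>0$. Suppose that $K'$ is obtained from $K$ by one of the following updates: * natural policy gradient: $K'=K-2\eta E_K$, with $\eta\le 1/(2\|R+B^\top\tilde P_KB\|)$; * Gauss–Newton: $K'=K-2\eta(R+B^\top\tilde P_KB)^{-1}E_K$, with $\eta\le 1/2$. Then $K'\in\mathcal K$. Equivalently, $\rho(A-BK')<1$ and there is a stabilizing Riccati solution $P_{K'}$ for $K'$; that is, a symmetric $P_{K'}\ge0$ that satisfies the Riccati equation for $K'$, $I-\gamma^{-2}D^\top P_{K'}D>0$ and $\rho\bigl((I-\gamma^{-2}P_{K'}DD^\top)^{-\top}(A-BK')\bigr)<1$. -/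

import Mathlib

open scoped ENNReal MatrixOrder Matrix.Norms.L2Operator

noncomputable section

namespace MixedDesign

section Systems

variable {ι κ ν : Type*} [Fintype ι] [DecidableEq ι] [Fintype κ] [DecidableEq κ]
  [Fintype ν] [DecidableEq ν]

/-- The spectral radius `ρ(M)` of a real square matrix: the largest modulus of its complex
eigenvalues. -/
def rho (M : Matrix ι ι ℝ) : ℝ≥0∞ :=
  spectralRadius ℂ (M.map Complex.ofReal)

/-- The discrete-time transfer function `G(z) = C (zI - A)⁻¹ B + D` of the system
`x_{t+1} = A x_t + B u_t`, `z_t = C x_t + D u_t`. -/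
def transferFunction (A : Matrix ι ι ℝ) (B : Matrix ι ν ℝ) (C : Matrix κ ι ℝ)
    (D : Matrix κ ν ℝ) (z : ℂ) : Matrix κ ν ℂ :=
  C.map Complex.ofReal * (z • (1 : Matrix ι ι ℂ) - A.map Complex.ofReal)⁻¹ * B.map Complex.ofReal
    + D.map Complex.ofReal

/-- The discrete-time `H_∞` norm: the supremum over the unit circle of the largest singular value
(the operator norm for the Euclidean norms) of `G`. The value is in `[0, ∞]`. -/
def hInfNorm (G : ℂ → Matrix κ ν ℂ) : ℝ≥0∞ :=
  ⨆ θ ∈ Set.Ico (0 : ℝ) (2 * Real.pi), ‖G (Complex.exp (Complex.I * (θ : ℂ)))‖ₑ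

end Systems

section Design

variable {m d n l : Type*} [Fintype m] [DecidableEq m] [Fintype d] [DecidableEq d]
  [Fintype n] [DecidableEq n] [Fintype l]

/-- The closed-loop transfer function `𝒯(K)` from the disturbance to the output: the system with
state matrix `A - B K`, input matrix `D`, output matrix `(Cᵀ C + Kᵀ R K)^{1/2}` and no feedthrough. -/
def closedLoop (A : Matrix m m ℝ) (B : Matrix m d ℝ) (C : Matrix l m ℝ) (D : Matrix m n ℝ)
    (R : Matrix d d ℝ) (K : Matrix d m ℝ) : ℂ → Matrix m n ℂ :=
  transferFunction (A - B * K) D (CFC.sqrt (C.transpose * C + K.transpose * R * K)) 0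

/-- The feasible set `𝒦` of mixed `H_2/H_∞` design:
`ρ(A - B K) < 1` and `‖𝒯(K)‖_∞ < γ`. -/
def feasibleSet (A : Matrix m m ℝ) (B : Matrix m d ℝ) (C : Matrix l m ℝ) (D : Matrix m n ℝ)
    (R : Matrix d d ℝ) (γ : ℝ) : Set (Matrix d m ℝ) :=
  {K | rho (A - B * K) < 1 ∧ hInfNorm (closedLoop A B C D R K) < ENNReal.ofReal γ}

/-- `P̃ = P + P D (γ² I - Dᵀ P D)⁻¹ Dᵀ P`. -/
def tildeP (D : Matrix m n ℝ) (γ : ℝ) (P : Matrix m m ℝ) : Matrix m m ℝ :=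
  P + P * D * (γ ^ 2 • (1 : Matrix n n ℝ) - D.transpose * P * D)⁻¹ * D.transpose * P

/-- `P` is a stabilizing solution of the Riccati equation
`(A - B K)ᵀ P̃ (A - B K) + Cᵀ C + Kᵀ R K - P = 0`: it is (symmetric) positive semidefinite, solves
the equation, and satisfies `I - γ⁻² Dᵀ P D > 0` and `ρ((I - γ⁻² P D Dᵀ)⁻ᵀ (A - B K)) < 1`. -/
structure IsStabilizingSolution (A : Matrix m m ℝ) (B : Matrix m d ℝ) (C : Matrix l m ℝ)
    (D : Matrix m n ℝ) (R : Matrix d d ℝ) (γ : ℝ) (K : Matrix d m ℝ) (P : Matrix m m ℝ) :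
    Prop where
  posSemidef : P.PosSemidef
  riccati : (A - B * K).transpose * tildeP D γ P * (A - B * K) + C.transpose * C
    + K.transpose * R * K - P = 0
  posDef : ((1 : Matrix n n ℝ) - (γ ^ 2)⁻¹ • (D.transpose * P * D)).PosDef
  stable : rho (((1 : Matrix m m ℝ) - (γ ^ 2)⁻¹ • (P * D * D.transpose))⁻¹.transpose
    * (A - B * K)) < 1

/-- The matrix `R + Bᵀ P̃ B`. -/
def hess (B : Matrix m d ℝ) (D : Matrix m n ℝ) (R : Matrix d d ℝ) (γ : ℝ) (P : Matrix m m ℝ) :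
    Matrix d d ℝ :=
  R + B.transpose * tildeP D γ P * B

/-- `E_K = (R + Bᵀ P̃ B) K - Bᵀ P̃ A`, with `P = P_K`. -/
def gradE (A : Matrix m m ℝ) (B : Matrix m d ℝ) (D : Matrix m n ℝ) (R : Matrix d d ℝ) (γ : ℝ)
    (P : Matrix m m ℝ) (K : Matrix d m ℝ) : Matrix d m ℝ :=
  hess B D R γ P * K - B.transpose * tildeP D γ P * A

/-- One natural policy gradient step `K' = K - 2 η E_K`, with `P = P_K`. -/
def npgStep (A : Matrix m m ℝ) (B : Matrix m d ℝ) (D : Matrix m n ℝ) (R : Matrix d d ℝ) (γ : ℝ)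
    (P : Matrix m m ℝ) (η : ℝ) (K : Matrix d m ℝ) : Matrix d m ℝ :=
  K - (2 * η) • gradE A B D R γ P K

/-- One Gauss–Newton step `K' = K - 2 η (R + Bᵀ P̃ B)⁻¹ E_K`, with `P = P_K`. -/
def gaussNewtonStep (A : Matrix m m ℝ) (B : Matrix m d ℝ) (D : Matrix m n ℝ) (R : Matrix d d ℝ)
    (γ : ℝ) (P : Matrix m m ℝ) (η : ℝ) (K : Matrix d m ℝ) : Matrix d m ℝ :=
  K - (2 * η) • ((hess B D R γ P)⁻¹ * gradE A B D R γ P K)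

end Design

end MixedDesign

end

/-!
The argument has three independent parts. Write `F = A - B K`, let `X` be the square root of
`Cᵀ C + Kᵀ R K`, and let `S = (I + D (γ² I - Dᵀ P D)⁻¹ Dᵀ P) F` be the closed loop under the
worst-case disturbance. By a push-through identity (`transpose_inv_eq_loop`) `S` is the matrix whose
stability makes `P` a stabilizing solution. Everything rests on completing the square in the
disturbance (`completion_of_squares`): `P̃` is the form obtained from `P` by maximizing
`|w + D u|²_P - γ² |u|²` over `u`.

*Existence* (`exists_stabilizing_of_mem_feasibleSet`) is the hard half of the bounded real lemma.
The frequency-domain bound is carried to the time domain by testing it on `N`-periodic signals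
(finite Parseval identity at the `N`-th roots of unity) and letting `N → ∞`; this gives the strict
dissipation inequality `exists_dissipation` on every finite horizon. The value iteration
`P ↦ Fᵀ P̃ F + Xᵀ X` from `P = 0` computes the optimal payoff of the disturbance over growing
horizons, so dissipativity bounds it and keeps `γ² I - Dᵀ P D` uniformly positive, and monotonicity
makes it converge to a solution `P`. Following the worst-case feedback of `P` and then an optimal
finite-horizon disturbance shows that the feedback has finite energy, which forces `S` to be stable
(`rho_worstCase_lt_one`).

*Uniqueness* (`eq_of_stabilizing`): the difference of two stabilizing solutions satisfies
`P₁ - P₂ = S₁ᵀ (P₁ - P₂) S₂`, and the powers of `S₁` and `S₂` tend to `0`.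

*Invariance* (`mem_feasibleSet_of_gradE`): for both updates the residual of `P` in the Riccati
equation of `K'` is `-(K' - K)ᵀ W (K' - K)` with `W` positive definite. If `K'` failed to be stable,
or if its transfer function attained gain `γ` at some frequency, then every nonnegative term of the
resulting identity would vanish; then `K'` and `K` act alike on the vector in question, which is
therefore an eigenvector of `S` on or outside the unit circle.
-/

noncomputable section

open Matrix Filter Topology
open scoped ComplexOrder

set_option linter.unusedSectionVars false

namespace MixedDesign

/-! ### Quadratic forms and completion of squares -/

section QuadraticForm

variable {ι κ ν 𝕜 : Type*} [Fintype ι] [Fintype κ] [Fintype ν] [RCLike 𝕜]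

/-- The quadratic form `v ↦ Re (v* P v)` of a square matrix. -/
def qf (P : Matrix ι ι 𝕜) (v : ι → 𝕜) : ℝ := RCLike.re (star v ⬝ᵥ P *ᵥ v)

/-- The squared Euclidean norm of a vector. -/
def nsq (v : ι → 𝕜) : ℝ := ∑ i, ‖v i‖ ^ 2

lemma nsq_nonneg (v : ι → 𝕜) : 0 ≤ nsq v := Finset.sum_nonneg fun _ _ => by positivity

lemma nsq_eq_zero {v : ι → 𝕜} : nsq v = 0 ↔ v = 0 := by
  unfold nsq
  rw [Finset.sum_eq_zero_iff_of_nonneg (fun _ _ => by positivity)]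
  simp [funext_iff]

@[simp] lemma nsq_zero : nsq (0 : ι → 𝕜) = 0 := nsq_eq_zero.2 rfl

lemma nsq_smul (c : 𝕜) (v : ι → 𝕜) : nsq (c • v) = ‖c‖ ^ 2 * nsq v := by
  simp [nsq, Finset.mul_sum, mul_pow]

lemma nsq_eq_norm_sq (v : ι → 𝕜) : nsq v = ‖WithLp.toLp 2 v‖ ^ 2 := by
  rw [EuclideanSpace.norm_sq_eq]; rfl

lemma nsq_eq_dotProduct (v : ι → 𝕜) : nsq v = RCLike.re (star v ⬝ᵥ v) := by
  simp only [nsq, dotProduct, Pi.star_apply, map_sum]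
  refine Finset.sum_congr rfl fun i _ => ?_
  rw [RCLike.star_def, RCLike.conj_mul]
  norm_cast

lemma nsq_mulVec_le [DecidableEq ν] (A : Matrix κ ν 𝕜) (v : ν → 𝕜) :
    nsq (A *ᵥ v) ≤ ‖A‖ ^ 2 * nsq v := by
  rw [nsq_eq_norm_sq, nsq_eq_norm_sq, ← mul_pow]
  exact pow_le_pow_left₀ (norm_nonneg _) (A.l2_opNorm_mulVec (WithLp.toLp 2 v)) 2

lemma nsq_ofReal (v : ι → ℝ) : nsq (fun i => (v i : ℂ)) = nsq v := by
  simp [nsq]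

/-- The weighted parallelogram bound `|v + w|² ≤ (1 + δ)|v|² + (1 + 1/δ)|w|²`. -/
lemma nsq_add_le {δ : ℝ} (hδ : 0 < δ) (v w : ι → 𝕜) :
    nsq (v + w) ≤ (1 + δ) * nsq v + (1 + δ⁻¹) * nsq w := by
  simp only [nsq, Finset.mul_sum, ← Finset.sum_add_distrib]
  refine Finset.sum_le_sum fun i _ => ?_
  have h1 : ‖(v + w) i‖ ^ 2 ≤ (‖v i‖ + ‖w i‖) ^ 2 :=
    pow_le_pow_left₀ (norm_nonneg _) (norm_add_le _ _) 2
  have h2 : 2 * (‖v i‖ * ‖w i‖) ≤ δ * ‖v i‖ ^ 2 + δ⁻¹ * ‖w i‖ ^ 2 := by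
    have h3 : 0 ≤ δ⁻¹ * (δ * ‖v i‖ - ‖w i‖) ^ 2 := by positivity
    have h4 : δ⁻¹ * (δ * ‖v i‖ - ‖w i‖) ^ 2
        = δ * ‖v i‖ ^ 2 + δ⁻¹ * ‖w i‖ ^ 2 - 2 * (‖v i‖ * ‖w i‖) := by
      field_simp
      ring
    linarith
  nlinarith

lemma qf_add (P Q : Matrix ι ι 𝕜) (v : ι → 𝕜) : qf (P + Q) v = qf P v + qf Q v := by
  simp [qf, add_mulVec]

lemma qf_sub (P Q : Matrix ι ι 𝕜) (v : ι → 𝕜) : qf (P - Q) v = qf P v - qf Q v := by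
  simp [qf, sub_mulVec]

lemma qf_smul_one [DecidableEq ι] (c : ℝ) (v : ι → 𝕜) :
    qf (c • (1 : Matrix ι ι 𝕜)) v = c * nsq v := by
  simp [qf, nsq_eq_dotProduct, smul_mulVec, RCLike.smul_re]

lemma qf_smul_vec (P : Matrix ι ι 𝕜) (c : 𝕜) (v : ι → 𝕜) :
    qf P (c • v) = ‖c‖ ^ 2 * qf P v := by
  have h : star (c • v) ⬝ᵥ P *ᵥ (c • v) = ((‖c‖ ^ 2 : ℝ) : 𝕜) * (star v ⬝ᵥ P *ᵥ v) := by
    rw [mulVec_smul, star_smul, smul_dotProduct, dotProduct_smul, smul_smul, smul_eq_mul,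
      RCLike.star_def, RCLike.conj_mul]
    norm_cast
  rw [qf, h, RCLike.re_ofReal_mul, qf]

lemma qf_conj (P : Matrix ι ι 𝕜) (F : Matrix ι κ 𝕜) (v : κ → 𝕜) :
    qf (Fᴴ * P * F) v = qf P (F *ᵥ v) := by
  simp only [qf, star_mulVec, ← mulVec_mulVec, dotProduct_mulVec, vecMul_vecMul]

lemma qf_conjTranspose_mul_self (F : Matrix ι κ 𝕜) (v : κ → 𝕜) :
    qf (Fᴴ * F) v = nsq (F *ᵥ v) := by
  simp only [qf, nsq_eq_dotProduct, star_mulVec, ← mulVec_mulVec, dotProduct_mulVec, vecMul_vecMul]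

lemma qf_nonneg {P : Matrix ι ι 𝕜} (hP : P.PosSemidef) (v : ι → 𝕜) : 0 ≤ qf P v :=
  hP.re_dotProduct_nonneg v

lemma eq_zero_of_qf [DecidableEq ι] {P : Matrix ι ι 𝕜} (hP : P.PosDef) {v : ι → 𝕜}
    (h : qf P v = 0) : v = 0 := by
  by_contra hv
  exact (hP.re_dotProduct_pos hv).ne' h

lemma posSemidef_of_qf {P : Matrix ι ι ℝ} (hP : P.IsHermitian) (h : ∀ v, 0 ≤ qf P v) :
    P.PosSemidef := .of_dotProduct_mulVec_nonneg hP h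

lemma posDef_of_qf {P : Matrix ι ι ℝ} (hP : P.IsHermitian) {ε : ℝ} (hε : 0 < ε)
    (h : ∀ v, ε * nsq v ≤ qf P v) : P.PosDef := by
  refine .of_dotProduct_mulVec_pos hP fun x hx => ?_
  refine lt_of_lt_of_le (mul_pos hε ?_) (h x)
  exact lt_of_le_of_ne (nsq_nonneg x) fun h0 => hx (nsq_eq_zero.1 h0.symm)

/-- Completion of squares in `u`. When `M = g - Dᴴ P D` is positive definite, it says that the
maximum over `u` of `|w + D u|²_P - g |u|²` is the value at `w` of the form `P + P D M⁻¹ Dᴴ P`. -/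
lemma completion_of_squares [DecidableEq ν] {P : Matrix ι ι 𝕜} {D : Matrix ι ν 𝕜}
    {M N : Matrix ν ν 𝕜} {g : ℝ} (hP : P.IsHermitian) (hM : M = g • (1 : Matrix ν ν 𝕜) - Dᴴ * P * D)
    (hN : N.IsHermitian) (hMN : M * N = 1) (hNM : N * M = 1) (w : ι → 𝕜) (u : ν → 𝕜) :
    qf P (w + D *ᵥ u) - g * nsq u =
      qf (P + P * D * N * Dᴴ * P) w - qf M (u - N *ᵥ (Dᴴ *ᵥ (P *ᵥ w))) := by
  have e1 : g * nsq u = qf M u + qf P (D *ᵥ u) := by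
    rw [← qf_smul_one, ← qf_conj, ← qf_add, hM, sub_add_cancel]
  have e2 : qf P (w + D *ᵥ u) = qf P w + qf P (D *ᵥ u)
      + RCLike.re (star w ⬝ᵥ P *ᵥ (D *ᵥ u)) + RCLike.re (star (D *ᵥ u) ⬝ᵥ P *ᵥ w) := by
    simp only [qf, star_add, mulVec_add, add_dotProduct, dotProduct_add, map_add]
    ring
  set r := Dᴴ *ᵥ (P *ᵥ w) with hr
  have e3 : star w ⬝ᵥ P *ᵥ (D *ᵥ u) = star r ⬝ᵥ u := by
    rw [hr, star_mulVec, star_mulVec, hP.eq, conjTranspose_conjTranspose, vecMul_vecMul,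
      ← dotProduct_mulVec, mulVec_mulVec]
  have e4 : star (D *ᵥ u) ⬝ᵥ P *ᵥ w = star u ⬝ᵥ r := by
    rw [hr, star_mulVec, ← dotProduct_mulVec]
  have e5 : qf (P + P * D * N * Dᴴ * P) w = qf P w + RCLike.re (star r ⬝ᵥ N *ᵥ r) := by
    rw [qf_add, hr]
    congr 1
    simp only [qf, star_mulVec, mulVec_mulVec, dotProduct_mulVec, vecMul_vecMul, conjTranspose_mul,
      hP.eq, conjTranspose_conjTranspose, Matrix.mul_assoc]
  have e6 : qf M (u - N *ᵥ r) = qf M u - RCLike.re (star r ⬝ᵥ u) - RCLike.re (star u ⬝ᵥ r)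
      + RCLike.re (star r ⬝ᵥ N *ᵥ r) := by
    simp only [qf, star_sub, mulVec_sub, sub_dotProduct, dotProduct_sub, map_sub, star_mulVec,
      hN.eq, mulVec_mulVec, dotProduct_mulVec, sub_vecMul, vecMul_vecMul, hMN, hNM, vecMul_one]
    ring
  rw [e1, e2, e3, e4, e5, e6]
  ring

end QuadraticForm

/-! ### Complexification of real matrices -/

section Complexification

variable {ι κ ν : Type*}

/-- The complexification of a real matrix. -/
abbrev toC (M : Matrix ι κ ℝ) : Matrix ι κ ℂ := M.map Complex.ofReal

lemma toC_mul [Fintype κ] (M : Matrix ι κ ℝ) (N : Matrix κ ν ℝ) : toC (M * N) = toC M * toC N :=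
  Matrix.map_mul (f := Complex.ofRealHom)

lemma toC_add (M N : Matrix ι κ ℝ) : toC (M + N) = toC M + toC N := by ext; simp

lemma toC_sub (M N : Matrix ι κ ℝ) : toC (M - N) = toC M - toC N := by ext; simp

lemma toC_smul (c : ℝ) (M : Matrix ι κ ℝ) : toC (c • M) = c • toC M := by ext; simp

lemma toC_one [DecidableEq ι] : toC (1 : Matrix ι ι ℝ) = 1 := by
  ext i j; by_cases h : i = j <;> simp [h, Matrix.one_apply]

lemma toC_transpose (M : Matrix ι κ ℝ) : toC Mᵀ = (toC M)ᴴ := by ext; simp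

lemma toC_mulVec_ofReal [Fintype κ] (M : Matrix ι κ ℝ) (v : κ → ℝ) :
    toC M *ᵥ (fun j => (v j : ℂ)) = fun i => ((M *ᵥ v) i : ℂ) := by
  ext i; simp [mulVec, dotProduct]

lemma toC_posSemidef [Fintype ι] {M : Matrix ι ι ℝ} (hM : M.PosSemidef) : (toC M).PosSemidef := by
  classical
  obtain ⟨B, rfl⟩ := CStarAlgebra.nonneg_iff_eq_star_mul_self.mp hM.nonneg
  rw [toC_mul, star_eq_conjTranspose, conjTranspose_eq_transpose_of_trivial, toC_transpose]
  exact posSemidef_conjTranspose_mul_self _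

lemma toC_posDef [Fintype ι] [DecidableEq ι] {M : Matrix ι ι ℝ} (hM : M.PosDef) :
    (toC M).PosDef := by
  rw [(toC_posSemidef hM.posSemidef).posDef_iff_isUnit]
  have h := (isUnit_iff_isUnit_det _).1 hM.isUnit
  refine IsUnit.of_mul_eq_one (toC M⁻¹) ?_
  rw [← toC_mul, mul_nonsing_inv _ h, toC_one]

end Complexification

/-! ### Spectral radius, eigenvectors and decay of powers -/

section SpectralRadius

variable {ι : Type*} [Fintype ι] [DecidableEq ι]

lemma mem_spectrum_iff_exists_eigenvector (M : Matrix ι ι ℂ) (z : ℂ) :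
    z ∈ spectrum ℂ M ↔ ∃ v : ι → ℂ, v ≠ 0 ∧ M *ᵥ v = z • v := by
  rw [spectrum.mem_iff, isUnit_iff_isUnit_det, isUnit_iff_ne_zero, not_not,
    ← exists_mulVec_eq_zero_iff]
  refine exists_congr fun v => and_congr_right fun _ => ?_
  rw [Algebra.algebraMap_eq_smul_one, sub_mulVec, smul_mulVec, one_mulVec, sub_eq_zero, eq_comm]

/-- The form with eigenvectors includes the empty index type, where there is no spectrum. -/
lemma rho_lt_one_iff (M : Matrix ι ι ℝ) :
    rho M < 1 ↔ ∀ (z : ℂ) (v : ι → ℂ), v ≠ 0 → toC M *ᵥ v = z • v → ‖z‖ < 1 := by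
  constructor
  · intro h z v hv hz
    have hz' : z ∈ spectrum ℂ (toC M) := (mem_spectrum_iff_exists_eigenvector _ _).2 ⟨v, hv, hz⟩
    have : (‖z‖₊ : ℝ≥0∞) < 1 := lt_of_le_of_lt (le_iSup₂ (α := ℝ≥0∞) z hz') h
    exact_mod_cast this
  · intro h
    rcases (spectrum ℂ (toC M)).eq_empty_or_nonempty with he | hne
    · have : rho M = 0 := by
        show spectralRadius ℂ (toC M) = 0
        simp [spectralRadius, he]
      simp [this]
    · have := spectrum.spectralRadius_lt_of_forall_lt_of_nonempty (r := 1) hne ?_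
      · exact_mod_cast this
      · intro z hz
        obtain ⟨v, hv, hz⟩ := (mem_spectrum_iff_exists_eigenvector _ _).1 hz
        exact_mod_cast h z v hv hz

/-- By Gelfand's formula the powers of a matrix of spectral radius below `1` decay
geometrically. -/
lemma summable_norm_pow {M : Matrix ι ι ℂ} (h : spectralRadius ℂ M < 1) :
    Summable fun k : ℕ => ‖M ^ k‖ := by
  obtain ⟨r, hr, hr1⟩ := ENNReal.lt_iff_exists_nnreal_btwn.1 h
  have hr1' : (r : ℝ) < 1 := by exact_mod_cast hr1
  refine Summable.of_norm_bounded_eventually_nat (g := fun k => (r : ℝ) ^ k)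
    (summable_geometric_of_lt_one r.2 hr1') ?_
  have h1 := (spectrum.pow_nnnorm_pow_one_div_tendsto_nhds_spectralRadius M).eventually_lt_const hr
  filter_upwards [h1, eventually_gt_atTop 0] with k hk hk0
  have h2 : ((‖M ^ k‖₊ : ℝ≥0∞) ^ (1 / k : ℝ)) ^ (k : ℝ) ≤ (r : ℝ≥0∞) ^ (k : ℝ) :=
    ENNReal.rpow_le_rpow hk.le (by positivity)
  rw [← ENNReal.rpow_mul, one_div_mul_cancel (by positivity), ENNReal.rpow_one,
    ENNReal.rpow_natCast] at h2
  rw [norm_norm]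
  exact_mod_cast h2

end SpectralRadius

/-! ### Transfer functions on the unit circle -/

section Resolvent

variable {ι κ ν : Type*} [Fintype ι] [DecidableEq ι] [Fintype κ] [DecidableEq κ] [Fintype ν]
  [DecidableEq ν]

lemma isUnit_resolvent {F : Matrix ι ι ℝ} (hF : rho F < 1) {z : ℂ} (hz : ‖z‖ = 1) :
    IsUnit (z • (1 : Matrix ι ι ℂ) - toC F).det := by
  rw [← isUnit_iff_isUnit_det, ← Algebra.algebraMap_eq_smul_one]
  by_contra h
  obtain ⟨v, hv, hv'⟩ := (mem_spectrum_iff_exists_eigenvector _ _).1 (spectrum.mem_iff.2 h)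
  exact ((rho_lt_one_iff F).1 hF z v hv hv').ne hz

lemma transferFunction_zero_mulVec (F : Matrix ι ι ℝ) (D : Matrix ι ν ℝ) (X : Matrix κ ι ℝ) (z : ℂ)
    (u : ν → ℂ) : transferFunction F D X 0 z *ᵥ u =
      toC X *ᵥ ((z • (1 : Matrix ι ι ℂ) - toC F)⁻¹ *ᵥ (toC D *ᵥ u)) := by
  have h : (0 : Matrix κ ν ℝ).map Complex.ofReal = 0 := by ext; simp
  rw [transferFunction, h, add_zero, ← mulVec_mulVec, ← mulVec_mulVec]

lemma resolvent_mulVec {F : Matrix ι ι ℝ} (hF : rho F < 1) {z : ℂ} (hz : ‖z‖ = 1) (b : ι → ℂ) :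
    z • ((z • (1 : Matrix ι ι ℂ) - toC F)⁻¹ *ᵥ b) =
      toC F *ᵥ ((z • (1 : Matrix ι ι ℂ) - toC F)⁻¹ *ᵥ b) + b := by
  have h : (z • (1 : Matrix ι ι ℂ) - toC F) *ᵥ ((z • (1 : Matrix ι ι ℂ) - toC F)⁻¹ *ᵥ b) = b := by
    rw [mulVec_mulVec, mul_nonsing_inv _ (isUnit_resolvent hF hz), one_mulVec]
  rw [sub_mulVec, smul_mulVec, one_mulVec, sub_eq_iff_eq_add] at h
  rw [h, add_comm]

lemma norm_exp_I_mul (θ : ℝ) : ‖Complex.exp (Complex.I * (θ : ℂ))‖ = 1 := by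
  rw [mul_comm]; exact Complex.norm_exp_ofReal_mul_I θ

lemma continuous_transferFunction {F : Matrix ι ι ℝ} (hF : rho F < 1) (D : Matrix ι ν ℝ)
    (X : Matrix κ ι ℝ) :
    Continuous fun θ : ℝ => transferFunction F D X 0 (Complex.exp (Complex.I * (θ : ℂ))) := by
  unfold transferFunction
  refine Continuous.add (Continuous.matrix_mul (Continuous.matrix_mul continuous_const ?_)
    continuous_const) continuous_const
  rw [continuous_iff_continuousAt]
  intro θ
  have h1 : ContinuousAt (Inv.inv : Matrix ι ι ℂ → Matrix ι ι ℂ)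
      (Complex.exp (Complex.I * (θ : ℂ)) • (1 : Matrix ι ι ℂ) - toC F) := by
    apply continuousAt_matrix_inv
    obtain ⟨c, hc⟩ := isUnit_resolvent hF (norm_exp_I_mul θ)
    rw [← hc]
    exact NormedRing.inverse_continuousAt c
  have h2 : Continuous fun θ : ℝ =>
      Complex.exp (Complex.I * (θ : ℂ)) • (1 : Matrix ι ι ℂ) - toC F := by fun_prop
  exact ContinuousAt.comp (f := fun θ : ℝ =>
      Complex.exp (Complex.I * (θ : ℂ)) • (1 : Matrix ι ι ℂ) - toC F) h1 h2.continuousAt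

lemma l2_opNorm_le_of_nsq {A : Matrix κ ν ℂ} {c : ℝ} (hc : 0 ≤ c)
    (h : ∀ u, nsq (A *ᵥ u) ≤ c ^ 2 * nsq u) : ‖A‖ ≤ c := by
  rw [l2_opNorm_def]
  refine ContinuousLinearMap.opNorm_le_bound _ hc fun u => ?_
  have := h u.ofLp
  rw [nsq_eq_norm_sq, nsq_eq_norm_sq, ← mul_pow] at this
  exact le_of_sq_le_sq this (by positivity)

/-- A stable transfer function that contracts every nonzero input strictly, at every frequency, by
more than the factor `γ` has `H_∞` norm below `γ`, since the unit circle and the unit sphere are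
compact. -/
lemma hInfNorm_lt_of_forall_nsq_lt {F : Matrix ι ι ℝ} (hF : rho F < 1) (D : Matrix ι ν ℝ)
    (X : Matrix κ ι ℝ) {γ : ℝ} (hγ : 0 < γ)
    (h : ∀ z : ℂ, ‖z‖ = 1 → ∀ u, u ≠ 0 →
      nsq (transferFunction F D X 0 z *ᵥ u) < γ ^ 2 * nsq u) :
    hInfNorm (transferFunction F D X 0) < ENNReal.ofReal γ := by
  set G := fun θ : ℝ => transferFunction F D X 0 (Complex.exp (Complex.I * (θ : ℂ))) with hG
  have hGc : Continuous G := continuous_transferFunction hF D X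
  set S := Set.Icc (0 : ℝ) (2 * Real.pi) ×ˢ Metric.sphere (0 : EuclideanSpace ℂ ν) 1
  have hS : IsCompact S := isCompact_Icc.prod (isCompact_sphere _ _)
  set f : ℝ × EuclideanSpace ℂ ν → ℝ := fun p => nsq (G p.1 *ᵥ p.2.ofLp)
  have hf : Continuous f := by
    have : Continuous fun p : ℝ × EuclideanSpace ℂ ν => G p.1 *ᵥ p.2.ofLp :=
      (hGc.comp continuous_fst).matrix_mulVec ((PiLp.continuous_ofLp 2 _).comp continuous_snd)
    simp only [f, nsq]
    fun_prop
  -- The sphere, hence `S`, is empty when there are no inputs.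
  obtain ⟨c, hc0, hc, hcS⟩ : ∃ c, 0 ≤ c ∧ c < γ ∧ ∀ p ∈ S, f p ≤ c ^ 2 := by
    rcases S.eq_empty_or_nonempty with he | hne
    · exact ⟨0, le_rfl, hγ, by simp [he]⟩
    · obtain ⟨p, hp, hmax⟩ := hS.exists_isMaxOn hne hf.continuousOn
      refine ⟨Real.sqrt (f p), Real.sqrt_nonneg _, ?_, fun q hq => ?_⟩
      · rw [Real.sqrt_lt' hγ]
        have hp2 : ‖p.2‖ = 1 := by simpa using hp.2
        have hne0 : p.2.ofLp ≠ 0 := by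
          intro h0
          have : p.2 = 0 := by ext i; simp [h0]
          simp [this] at hp2
        have := h _ (norm_exp_I_mul p.1) p.2.ofLp hne0
        rw [nsq_eq_norm_sq p.2.ofLp] at this
        simpa [hp2] using this
      · rw [Real.sq_sqrt (nsq_nonneg _)]
        exact hmax hq
  have hle : hInfNorm (transferFunction F D X 0) ≤ ENNReal.ofReal c := by
    refine iSup₂_le fun θ hθ => ?_
    rw [← ofReal_norm]
    refine ENNReal.ofReal_le_ofReal (l2_opNorm_le_of_nsq hc0 fun u => ?_)
    rcases eq_or_ne u 0 with rfl | hu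
    · simp
    have hu' : WithLp.toLp 2 u ≠ 0 := by simpa using hu
    have hn : ‖WithLp.toLp 2 u‖ ≠ 0 := norm_ne_zero_iff.2 hu'
    set a : ℂ := ((‖WithLp.toLp 2 u‖⁻¹ : ℝ) : ℂ) with ha
    have hmem : (θ, a • WithLp.toLp 2 u) ∈ S := by
      refine ⟨⟨hθ.1, hθ.2.le⟩, ?_⟩
      rw [mem_sphere_zero_iff_norm, norm_smul, ha, Complex.norm_real, norm_inv, norm_norm,
        inv_mul_cancel₀ hn]
    have h1 := hcS _ hmem
    have h2 : f (θ, a • WithLp.toLp 2 u) = ‖a‖ ^ 2 * nsq (G θ *ᵥ u) := by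
      simp only [f, WithLp.ofLp_smul, mulVec_smul, nsq_smul]
    rw [h2, ha, Complex.norm_real, norm_inv, norm_norm, inv_pow, inv_mul_le_iff₀ (by positivity),
      ← nsq_eq_norm_sq, mul_comm] at h1
    exact h1
  exact hle.trans_lt ((ENNReal.ofReal_lt_ofReal_iff hγ).2 hc)

end Resolvent

/-! ### Algebra of the Riccati operator -/

section RiccatiAlgebra

variable {m n : Type*} [Fintype m] [DecidableEq m] [Fintype n] [DecidableEq n]

/-- The matrix `γ² I - Dᵀ P D`. -/
def gap (D : Matrix m n ℝ) (γ : ℝ) (P : Matrix m m ℝ) : Matrix n n ℝ :=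
  γ ^ 2 • (1 : Matrix n n ℝ) - Dᵀ * P * D

/-- The feedback matrix `(γ² I - Dᵀ P D)⁻¹ Dᵀ P` of the worst disturbance: `u = worstGain w`
maximizes `|w + D u|²_P - γ² |u|²`. -/
def worstGain (D : Matrix m n ℝ) (γ : ℝ) (P : Matrix m m ℝ) : Matrix n m ℝ :=
  (gap D γ P)⁻¹ * Dᵀ * P

variable {D : Matrix m n ℝ} {γ : ℝ} {P : Matrix m m ℝ}

lemma gap_posDef_iff (hγ : 0 < γ) :
    (gap D γ P).PosDef ↔ ((1 : Matrix n n ℝ) - (γ ^ 2)⁻¹ • (Dᵀ * P * D)).PosDef := by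
  have h : gap D γ P = γ ^ 2 • ((1 : Matrix n n ℝ) - (γ ^ 2)⁻¹ • (Dᵀ * P * D)) := by
    rw [smul_sub, smul_smul, mul_inv_cancel₀ (by positivity), one_smul, gap]
  constructor
  · intro hp
    have := hp.smul (inv_pos.2 (pow_pos hγ 2))
    rwa [h, smul_smul, inv_mul_cancel₀ (by positivity), one_smul] at this
  · intro hp
    rw [h]
    exact hp.smul (pow_pos hγ 2)

lemma tildeP_eq_mul : tildeP D γ P = P * (1 + D * worstGain D γ P) := by
  simp only [tildeP, worstGain, gap, Matrix.mul_add, Matrix.mul_one, Matrix.mul_assoc]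

lemma transpose_eq_of_isHermitian (hP : P.IsHermitian) : Pᵀ = P := by
  rw [← conjTranspose_eq_transpose_of_trivial]; exact hP

lemma gap_isHermitian (hP : P.IsHermitian) : (gap D γ P).IsHermitian := by
  rw [IsHermitian, conjTranspose_eq_transpose_of_trivial, gap]
  simp [transpose_eq_of_isHermitian hP, Matrix.mul_assoc]

lemma transpose_loop (hP : P.IsHermitian) :
    (1 + D * worstGain D γ P)ᵀ = 1 + P * D * (gap D γ P)⁻¹ * Dᵀ := by
  have h := transpose_eq_of_isHermitian (gap_isHermitian (D := D) (γ := γ) hP).inv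
  simp only [worstGain, transpose_add, transpose_one, transpose_mul, transpose_eq_of_isHermitian hP,
    h, transpose_transpose, Matrix.mul_assoc]

lemma tildeP_isHermitian (hP : P.IsHermitian) : (tildeP D γ P).IsHermitian := by
  have h := transpose_eq_of_isHermitian (gap_isHermitian (D := D) (γ := γ) hP).inv
  rw [IsHermitian, conjTranspose_eq_transpose_of_trivial, tildeP]
  change (P + P * D * (gap D γ P)⁻¹ * Dᵀ * P)ᵀ = P + P * D * (gap D γ P)⁻¹ * Dᵀ * P
  simp only [transpose_add, transpose_mul, transpose_eq_of_isHermitian hP, h, transpose_transpose,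
    Matrix.mul_assoc]

lemma tildeP_eq_transpose_mul (hP : P.IsHermitian) :
    tildeP D γ P = (1 + D * worstGain D γ P)ᵀ * P := by
  rw [transpose_loop hP, Matrix.add_mul, Matrix.one_mul, tildeP, gap]

/-- A push-through identity: `(I - γ⁻² P D Dᵀ)⁻ᵀ = I + D (γ² I - Dᵀ P D)⁻¹ Dᵀ P`. -/
lemma sub_mul_transpose_loop (hγ : 0 < γ) (hP : P.IsHermitian) (hgap : (gap D γ P).PosDef) :
    (1 - (γ ^ 2)⁻¹ • (P * D * Dᵀ)) * (1 + D * worstGain D γ P)ᵀ = 1 := by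
  set N := (gap D γ P)⁻¹ with hN
  have hNM : Dᵀ * P * D * N = γ ^ 2 • N - 1 := by
    have h1 : gap D γ P * N = 1 := mul_nonsing_inv _ ((isUnit_iff_isUnit_det _).1 hgap.isUnit)
    rw [gap, Matrix.sub_mul, Matrix.smul_mul, Matrix.one_mul] at h1
    rw [← h1]; abel
  have h2 : P * D * Dᵀ * (P * D * N * Dᵀ) = P * D * (Dᵀ * P * D * N) * Dᵀ := by
    simp only [Matrix.mul_assoc]
  rw [transpose_loop hP, ← hN, Matrix.mul_add, Matrix.mul_one, Matrix.sub_mul, Matrix.one_mul,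
    Matrix.smul_mul, h2, hNM, Matrix.mul_sub, Matrix.sub_mul, Matrix.mul_one, Matrix.mul_smul,
    Matrix.smul_mul, smul_sub, smul_smul, inv_mul_cancel₀ (by positivity), one_smul]
  abel

lemma transpose_inv_eq_loop (hγ : 0 < γ) (hP : P.IsHermitian) (hgap : (gap D γ P).PosDef) :
    (1 - (γ ^ 2)⁻¹ • (P * D * Dᵀ))⁻¹ᵀ = 1 + D * worstGain D γ P := by
  rw [inv_eq_right_inv (sub_mul_transpose_loop hγ hP hgap), transpose_transpose]

/-- The completion of squares over the reals. -/
lemma qf_add_mulVec (hP : P.IsHermitian) (hgap : (gap D γ P).PosDef) (w : m → ℝ) (u : n → ℝ) :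
    qf P (w + D *ᵥ u) - γ ^ 2 * nsq u =
      qf (tildeP D γ P) w - qf (gap D γ P) (u - worstGain D γ P *ᵥ w) := by
  have hu := (isUnit_iff_isUnit_det _).1 hgap.isUnit
  have := completion_of_squares hP (D := D) (M := gap D γ P) (g := γ ^ 2) (by simp [gap])
    hgap.inv.isHermitian (mul_nonsing_inv _ hu) (nonsing_inv_mul _ hu) w u
  rw [this, tildeP, worstGain]
  simp [gap, mulVec_mulVec, Matrix.mul_assoc]

/-- The completion of squares for complex vectors and real matrices. -/
lemma qf_add_mulVec_complex (hP : P.PosSemidef) (hgap : (gap D γ P).PosDef) (w : m → ℂ)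
    (u : n → ℂ) :
    qf (toC P) (w + toC D *ᵥ u) - γ ^ 2 * nsq u = qf (toC (tildeP D γ P)) w
      - qf (toC (gap D γ P)) (u - toC (worstGain D γ P) *ᵥ w) := by
  have hu := (isUnit_iff_isUnit_det _).1 hgap.isUnit
  have := completion_of_squares (toC_posSemidef hP).isHermitian (D := toC D)
    (M := toC (gap D γ P)) (N := toC (gap D γ P)⁻¹) (g := γ ^ 2)
    (by rw [gap, toC_sub, toC_smul, toC_one, toC_mul, toC_mul, toC_transpose])
    (toC_posDef hgap.inv).isHermitian
    (by rw [← toC_mul, mul_nonsing_inv _ hu, toC_one])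
    (by rw [← toC_mul, nonsing_inv_mul _ hu, toC_one]) w u
  rw [this, tildeP, worstGain]
  simp only [toC_add, toC_mul, toC_transpose, gap, mulVec_mulVec, Matrix.mul_assoc]

lemma qf_tildeP_complex (hP : P.PosSemidef) (hgap : (gap D γ P).PosDef) (w : m → ℂ) :
    qf (toC (tildeP D γ P)) w =
      qf (toC P) w + qf (toC (gap D γ P)) (toC (worstGain D γ P) *ᵥ w) := by
  have h := qf_add_mulVec_complex hP hgap w 0
  have h' : ∀ x : n → ℂ, qf (toC (gap D γ P)) (0 - x) = qf (toC (gap D γ P)) x := fun x => by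
    have := qf_smul_vec (toC (gap D γ P)) (-1) x
    simpa using this
  rw [h'] at h
  simp only [mulVec_zero, add_zero, nsq_zero, mul_zero, sub_zero] at h
  linarith

end RiccatiAlgebra

/-! ### Supersolutions of the Riccati equation -/

section Descent

variable {m d n p : Type*} [Fintype m] [DecidableEq m] [Fintype d] [DecidableEq d]
  [Fintype n] [DecidableEq n] [Fintype p] [DecidableEq p]
  {F F' : Matrix m m ℝ} {B : Matrix m d ℝ} {D : Matrix m n ℝ} {X : Matrix p m ℝ}
  {Δ : Matrix d m ℝ} {W : Matrix d d ℝ} {γ : ℝ} {P : Matrix m m ℝ}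

lemma qf_eq_of_residual (hres : P = F'ᵀ * tildeP D γ P * F' + Xᵀ * X + Δᵀ * W * Δ) (x : m → ℂ) :
    qf (toC P) x = qf (toC (tildeP D γ P)) (toC F' *ᵥ x) + nsq (toC X *ᵥ x)
      + qf (toC W) (toC Δ *ᵥ x) := by
  conv_lhs => rw [hres]
  rw [toC_add, toC_add, qf_add, qf_add, toC_mul, toC_mul, toC_mul, toC_mul, toC_mul, toC_transpose,
    toC_transpose, toC_transpose, qf_conj, qf_conj, qf_conjTranspose_mul_self]

/-- If `P` is a Riccati supersolution for `F' = F - B Δ` whose residual is definite in `Δ`, and the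
worst-case closed loop of `F` is stable, then `F'` is stable: an eigenvector of `F'` for an
eigenvalue outside the open disc is annihilated by `Δ` and by the worst-case gain, hence is an
eigenvector of the worst-case closed loop. -/
lemma rho_lt_one_of_residual (hP : P.PosSemidef) (hgap : (gap D γ P).PosDef) (hW : W.PosDef)
    (hF' : F' = F - B * Δ) (hS : rho ((1 + D * worstGain D γ P) * F) < 1)
    (hres : P = F'ᵀ * tildeP D γ P * F' + Xᵀ * X + Δᵀ * W * Δ) : rho F' < 1 := by
  rw [rho_lt_one_iff] at hS ⊢
  intro z v hv hz
  by_contra! hz1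
  have h1 := qf_eq_of_residual hres v
  rw [hz, qf_smul_vec, qf_tildeP_complex hP hgap] at h1
  have a1 := qf_nonneg (toC_posSemidef hP) v
  have a2 := qf_nonneg (toC_posDef hgap).posSemidef (toC (worstGain D γ P) *ᵥ v)
  have a3 := qf_nonneg (toC_posDef hW).posSemidef (toC Δ *ᵥ v)
  have a4 := nsq_nonneg (toC X *ᵥ v)
  have hz2 : 1 ≤ ‖z‖ ^ 2 := one_le_pow₀ hz1
  have b1 : qf (toC W) (toC Δ *ᵥ v) = 0 := by nlinarith
  have b2 : qf (toC (gap D γ P)) (toC (worstGain D γ P) *ᵥ v) = 0 := by nlinarith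
  have hΔ := eq_zero_of_qf (toC_posDef hW) b1
  have hG := eq_zero_of_qf (toC_posDef hgap) b2
  have hFv : toC F *ᵥ v = z • v := by
    rw [← hz, hF', toC_sub, toC_mul, sub_mulVec, ← mulVec_mulVec, hΔ, mulVec_zero, sub_zero]
  refine (hS z v hv ?_).not_ge hz1
  rw [toC_mul, ← mulVec_mulVec, hFv, toC_add, toC_one, toC_mul, add_mulVec, one_mulVec,
    ← mulVec_mulVec, mulVec_smul, hG, smul_zero, mulVec_zero, add_zero]

/-- Under the hypotheses of `rho_lt_one_of_residual` the `H_∞` norm of the system `(F', D, X)` is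
below `γ`: equality of gain at some frequency would force a nonzero eigenvector of the worst-case
closed loop on the unit circle. -/
lemma hInfNorm_lt_of_residual (hγ : 0 < γ) (hP : P.PosSemidef) (hgap : (gap D γ P).PosDef)
    (hW : W.PosDef) (hF' : F' = F - B * Δ) (hS : rho ((1 + D * worstGain D γ P) * F) < 1)
    (hres : P = F'ᵀ * tildeP D γ P * F' + Xᵀ * X + Δᵀ * W * Δ) :
    hInfNorm (transferFunction F' D X 0) < ENNReal.ofReal γ := by
  have hρ := rho_lt_one_of_residual hP hgap hW hF' hS hres
  refine hInfNorm_lt_of_forall_nsq_lt hρ D X hγ fun z hz u hu => ?_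
  rw [transferFunction_zero_mulVec]
  have hx := resolvent_mulVec hρ hz (toC D *ᵥ u)
  generalize (z • (1 : Matrix m m ℂ) - toC F')⁻¹ *ᵥ (toC D *ᵥ u) = x at hx ⊢
  have h1 := qf_eq_of_residual hres x
  have h2 := qf_add_mulVec_complex hP hgap (toC F' *ᵥ x) u
  rw [← hx, qf_smul_vec, hz, one_pow, one_mul] at h2
  have a2 := qf_nonneg (toC_posDef hgap).posSemidef (u - toC (worstGain D γ P) *ᵥ toC F' *ᵥ x)
  have a3 := qf_nonneg (toC_posDef hW).posSemidef (toC Δ *ᵥ x)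
  by_contra! hcon
  have hΔ := eq_zero_of_qf (toC_posDef hW) (v := toC Δ *ᵥ x) (by linarith)
  have hG := eq_zero_of_qf (toC_posDef hgap) (v := u - toC (worstGain D γ P) *ᵥ toC F' *ᵥ x)
    (by linarith)
  rw [sub_eq_zero] at hG
  have hFx : toC F' *ᵥ x = toC F *ᵥ x := by
    rw [hF', toC_sub, toC_mul, sub_mulVec, ← mulVec_mulVec, hΔ, mulVec_zero, sub_zero]
  have hx0 : x = 0 := by
    by_contra hne
    refine ((rho_lt_one_iff _).1 hS z x hne ?_).ne hz
    rw [hx, hG, hFx, toC_mul, toC_add, toC_one, toC_mul, ← mulVec_mulVec, add_mulVec, one_mulVec,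
      ← mulVec_mulVec]
  exact hu (by rw [hG, hx0, mulVec_zero, mulVec_zero])

end Descent

/-! ### Uniqueness of the stabilizing solution -/

section Uniqueness

variable {m n : Type*} [Fintype m] [DecidableEq m] [Fintype n] [DecidableEq n]
  {F : Matrix m m ℝ} {D : Matrix m n ℝ} {γ : ℝ} {P P₁ P₂ Q : Matrix m m ℝ}

lemma toC_pow (M : Matrix m m ℝ) (k : ℕ) : toC (M ^ k) = toC M ^ k := by
  induction k with
  | zero => simp
  | succ k ih => rw [pow_succ, pow_succ, toC_mul, ih]

/-- The difference of `P₁ (I - γ⁻² D Dᵀ P₁)⁻¹` and `P₂ (I - γ⁻² D Dᵀ P₂)⁻¹`, by the resolvent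
identity. -/
lemma tildeP_sub_tildeP (hγ : 0 < γ) (h₁ : P₁.IsHermitian) (h₂ : P₂.IsHermitian)
    (hg₁ : (gap D γ P₁).PosDef) (hg₂ : (gap D γ P₂).PosDef) :
    tildeP D γ P₁ - tildeP D γ P₂ =
      (1 + D * worstGain D γ P₁)ᵀ * (P₁ - P₂) * (1 + D * worstGain D γ P₂) := by
  have e1 := mul_eq_one_comm.1 (sub_mul_transpose_loop hγ h₁ hg₁)
  have e2 := congrArg transpose (mul_eq_one_comm.1 (sub_mul_transpose_loop hγ h₂ hg₂))
  have e3 : (1 - (γ ^ 2)⁻¹ • (P₂ * D * Dᵀ))ᵀ = 1 - (γ ^ 2)⁻¹ • (D * Dᵀ * P₂) := by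
    simp [transpose_eq_of_isHermitian h₂, Matrix.mul_assoc]
  rw [transpose_mul, transpose_transpose, transpose_one, e3] at e2
  have e4 : P₁ - P₂ =
      P₁ * (1 - (γ ^ 2)⁻¹ • (D * Dᵀ * P₂)) - (1 - (γ ^ 2)⁻¹ • (P₁ * D * Dᵀ)) * P₂ := by
    simp only [Matrix.mul_sub, Matrix.sub_mul, Matrix.mul_one, Matrix.one_mul, Matrix.mul_smul,
      Matrix.smul_mul, Matrix.mul_assoc]
    abel
  rw [tildeP_eq_transpose_mul h₁, tildeP_eq_mul (P := P₂), e4]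
  set W₁ := (1 + D * worstGain D γ P₁)ᵀ
  set W₂ := 1 + D * worstGain D γ P₂
  calc W₁ * P₁ - P₂ * W₂
      = W₁ * P₁ * ((1 - (γ ^ 2)⁻¹ • (D * Dᵀ * P₂)) * W₂)
          - (W₁ * (1 - (γ ^ 2)⁻¹ • (P₁ * D * Dᵀ))) * (P₂ * W₂) := by
        rw [e1, e2, Matrix.mul_one, Matrix.one_mul]
    _ = _ := by
        generalize 1 - (γ ^ 2)⁻¹ • (D * Dᵀ * P₂) = N₂
        generalize 1 - (γ ^ 2)⁻¹ • (P₁ * D * Dᵀ) = N₁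
        simp only [Matrix.mul_sub, Matrix.sub_mul, Matrix.mul_assoc]

/-- Two stabilizing solutions of the Riccati equation agree: their difference `X` satisfies
`X = S₁ᵀ X S₂` with both worst-case closed loops `Sᵢ` stable. -/
lemma eq_of_stabilizing (hγ : 0 < γ) (h₁ : P₁.IsHermitian) (h₂ : P₂.IsHermitian)
    (hg₁ : (gap D γ P₁).PosDef) (hg₂ : (gap D γ P₂).PosDef)
    (hr₁ : P₁ = Fᵀ * tildeP D γ P₁ * F + Q) (hr₂ : P₂ = Fᵀ * tildeP D γ P₂ * F + Q)
    (hs₁ : rho ((1 + D * worstGain D γ P₁) * F) < 1)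
    (hs₂ : rho ((1 + D * worstGain D γ P₂) * F) < 1) : P₁ = P₂ := by
  set S₁ := (1 + D * worstGain D γ P₁) * F with hS₁
  set S₂ := (1 + D * worstGain D γ P₂) * F with hS₂
  have hX : P₁ - P₂ = S₁ᵀ * (P₁ - P₂) * S₂ := by
    calc P₁ - P₂ = Fᵀ * (tildeP D γ P₁ - tildeP D γ P₂) * F := by
          conv_lhs => rw [hr₁, hr₂]
          rw [Matrix.mul_sub, Matrix.sub_mul]; abel
      _ = _ := by
          rw [tildeP_sub_tildeP hγ h₁ h₂ hg₁ hg₂, hS₁, hS₂, transpose_mul]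
          simp only [Matrix.mul_assoc]
  clear_value S₁ S₂
  have hXk : ∀ k : ℕ, P₁ - P₂ = (S₁ ^ k)ᵀ * (P₁ - P₂) * S₂ ^ k := by
    intro k
    induction k with
    | zero => simp
    | succ k ih =>
      calc P₁ - P₂ = S₁ᵀ * ((S₁ ^ k)ᵀ * (P₁ - P₂) * S₂ ^ k) * S₂ := by rw [← ih]; exact hX
        _ = _ := by
          rw [pow_succ, pow_succ, transpose_mul]
          simp only [Matrix.mul_assoc]
  have hlim : Tendsto (fun k : ℕ => ‖toC S₁ ^ k‖ * ‖toC (P₁ - P₂)‖ * ‖toC S₂ ^ k‖) atTop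
      (𝓝 0) := by
    simpa using ((summable_norm_pow hs₁).tendsto_atTop_zero.mul_const ‖toC (P₁ - P₂)‖).mul
      (summable_norm_pow hs₂).tendsto_atTop_zero
  have hle : ∀ k : ℕ, ‖toC (P₁ - P₂)‖ ≤ ‖toC S₁ ^ k‖ * ‖toC (P₁ - P₂)‖ * ‖toC S₂ ^ k‖ := by
    intro k
    conv_lhs => rw [hXk k, toC_mul, toC_mul, toC_transpose, toC_pow, toC_pow]
    refine (l2_opNorm_mul _ _).trans ?_
    gcongr
    refine (l2_opNorm_mul _ _).trans ?_
    rw [l2_opNorm_conjTranspose]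
  have h0 : toC (P₁ - P₂) = 0 :=
    norm_le_zero_iff.1 (ge_of_tendsto' hlim hle)
  rw [← sub_eq_zero]
  ext i j
  exact Complex.ofReal_eq_zero.1 (congrFun (congrFun h0 i) j)

end Uniqueness

/-! ### Policy updates preserve feasibility -/

section Design

variable {m d n l : Type*} [Fintype m] [DecidableEq m] [Fintype d] [DecidableEq d]
  [Fintype n] [DecidableEq n] [Fintype l]
  {A : Matrix m m ℝ} {B : Matrix m d ℝ} {C : Matrix l m ℝ} {D : Matrix m n ℝ}
  {R : Matrix d d ℝ} {γ : ℝ} {K : Matrix d m ℝ} {P : Matrix m m ℝ}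

lemma isStabilizingSolution_iff (hγ : 0 < γ) :
    IsStabilizingSolution A B C D R γ K P ↔ P.PosSemidef ∧ (gap D γ P).PosDef ∧
      P = (A - B * K)ᵀ * tildeP D γ P * (A - B * K) + (Cᵀ * C + Kᵀ * R * K) ∧
      rho ((1 + D * worstGain D γ P) * (A - B * K)) < 1 := by
  constructor
  · rintro ⟨h1, h2, h3, h4⟩
    have hg := (gap_posDef_iff hγ).2 h3
    refine ⟨h1, hg, ?_, ?_⟩
    · rw [sub_eq_zero] at h2
      rw [← add_assoc, h2]
    · rwa [transpose_inv_eq_loop hγ h1.isHermitian hg] at h4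
  · rintro ⟨h1, hg, h2, h4⟩
    refine ⟨h1, ?_, (gap_posDef_iff hγ).1 hg, ?_⟩
    · rw [add_assoc, ← h2, sub_self]
    · rwa [transpose_inv_eq_loop hγ h1.isHermitian hg]

lemma outputWeight_posSemidef (hR : R.PosDef) (C : Matrix l m ℝ) (K : Matrix d m ℝ) :
    (Cᵀ * C + Kᵀ * R * K).PosSemidef := by
  have h1 := posSemidef_conjTranspose_mul_self C
  have h2 := hR.posSemidef.conjTranspose_mul_mul_same K
  rw [conjTranspose_eq_transpose_of_trivial] at h1 h2
  exact h1.add h2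

lemma sqrt_transpose_mul_sqrt {Q : Matrix m m ℝ} (hQ : Q.PosSemidef) :
    (CFC.sqrt Q)ᵀ * CFC.sqrt Q = Q := by
  have h1 : (CFC.sqrt Q).PosSemidef := nonneg_iff_posSemidef.1 (CFC.sqrt_nonneg Q)
  rw [transpose_eq_of_isHermitian h1.isHermitian]
  exact CFC.sqrt_mul_sqrt_self Q hQ.nonneg

/-- `hess` is positive definite, since `P̃ ≥ 0`. -/
lemma hess_posDef (hR : R.PosDef) (hP : P.PosSemidef) (hgap : (gap D γ P).PosDef) :
    (hess B D R γ P).PosDef := by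
  have h0 : (tildeP D γ P).PosSemidef := by
    have h1 := hgap.inv.posSemidef.conjTranspose_mul_mul_same (Dᵀ * P)
    rw [conjTranspose_eq_transpose_of_trivial, transpose_mul, transpose_transpose,
      transpose_eq_of_isHermitian hP.isHermitian] at h1
    have h2 : tildeP D γ P = P + P * D * (gap D γ P)⁻¹ * (Dᵀ * P) := by
      rw [← Matrix.mul_assoc]; rfl
    rw [h2]
    exact hP.add h1
  have h1 := h0.conjTranspose_mul_mul_same B
  rw [conjTranspose_eq_transpose_of_trivial] at h1
  exact hR.add_posSemidef h1

/-- A policy step `K' - K` with `E_K = -G (K' - K)` and `2 G - (R + Bᵀ P̃ B)` positive definite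
keeps `K` feasible: the Riccati residual of `P` at `K'` is
`-(K' - K)ᵀ (2 G - R - Bᵀ P̃ B) (K' - K)`. -/
lemma mem_feasibleSet_of_gradE (hγ : 0 < γ) (hR : R.PosDef)
    (hP : IsStabilizingSolution A B C D R γ K P) {K' : Matrix d m ℝ} {G : Matrix d d ℝ}
    (hG : G.IsHermitian) (hE : gradE A B D R γ P K = -(G * (K' - K)))
    (hW : (2 • G - hess B D R γ P).PosDef) : K' ∈ feasibleSet A B C D R γ := by
  obtain ⟨hp, hg, hric, hs⟩ := (isStabilizingSolution_iff hγ).1 hP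
  set F := A - B * K with hF
  set Δ := K' - K with hΔ
  have hF' : A - B * K' = F - B * Δ := by
    rw [hF, hΔ, Matrix.mul_sub]; abel
  have hK' : K' = K + Δ := by rw [hΔ]; abel
  have hQ := sqrt_transpose_mul_sqrt (outputWeight_posSemidef hR C K')
  have hEt : (gradE A B D R γ P K)ᵀ = -(Δᵀ * G) := by
    rw [hE, transpose_neg, transpose_mul, transpose_eq_of_isHermitian hG]
  have hT := transpose_eq_of_isHermitian (tildeP_isHermitian (D := D) (γ := γ) hp.isHermitian)
  have hRt := transpose_eq_of_isHermitian hR.isHermitian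
  have hE1 : gradE A B D R γ P K = R * K - Bᵀ * tildeP D γ P * F := by
    rw [gradE, hess, hF]
    simp only [Matrix.add_mul, Matrix.mul_sub, Matrix.mul_assoc]
    abel
  have hE2 : (gradE A B D R γ P K)ᵀ = Kᵀ * R - Fᵀ * tildeP D γ P * B := by
    rw [hE1]
    simp only [transpose_sub, transpose_mul, hT, hRt, transpose_transpose, Matrix.mul_assoc]
  have hres : P = (A - B * K')ᵀ * tildeP D γ P * (A - B * K')
      + (CFC.sqrt (Cᵀ * C + K'ᵀ * R * K'))ᵀ * CFC.sqrt (Cᵀ * C + K'ᵀ * R * K')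
      + Δᵀ * (2 • G - hess B D R γ P) * Δ := by
    have c1 : Δᵀ * (2 • G) * Δ
        = -((gradE A B D R γ P K)ᵀ * Δ) - Δᵀ * gradE A B D R γ P K := by
      rw [hEt, hE]
      simp only [Matrix.neg_mul, Matrix.mul_neg, neg_neg, two_nsmul, Matrix.mul_add, Matrix.add_mul,
        sub_neg_eq_add, Matrix.mul_assoc]
    rw [hQ, Matrix.mul_sub Δᵀ, Matrix.sub_mul (Δᵀ * (2 • G)), c1, hE1, hF', hK', ← hE1, hE2, hE1,
      hess]
    conv_lhs => rw [hric]
    simp only [transpose_sub, transpose_add, transpose_mul, Matrix.sub_mul, Matrix.mul_sub,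
      Matrix.add_mul, Matrix.mul_add, Matrix.mul_assoc]
    abel
  exact ⟨rho_lt_one_of_residual hp hg hW hF' hs hres,
    hInfNorm_lt_of_residual hγ hp hg hW hF' hs hres⟩

lemma qf_le_norm_mul_nsq (H : Matrix d d ℝ) (v : d → ℝ) : qf H v ≤ ‖H‖ * nsq v := by
  have h1 : qf H v = inner ℝ (WithLp.toLp 2 v) (WithLp.toLp 2 (H *ᵥ v)) := by
    simp [qf, EuclideanSpace.inner_eq_star_dotProduct, dotProduct_comm]
  rw [h1, nsq_eq_norm_sq]
  refine (real_inner_le_norm _ _).trans ?_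
  have := H.l2_opNorm_mulVec (WithLp.toLp 2 v)
  calc _ ≤ ‖WithLp.toLp 2 v‖ * (‖H‖ * ‖WithLp.toLp 2 v‖) := by gcongr; exact this
    _ = _ := by ring

lemma npgStep_mem_feasibleSet (hγ : 0 < γ) (hR : R.PosDef)
    (hP : IsStabilizingSolution A B C D R γ K P) {η : ℝ} (hη : 0 < η)
    (hη' : η ≤ 1 / (2 * ‖hess B D R γ P‖)) :
    npgStep A B D R γ P η K ∈ feasibleSet A B C D R γ := by
  obtain ⟨hp, hg, -, -⟩ := (isStabilizingSolution_iff hγ).1 hP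
  refine mem_feasibleSet_of_gradE hγ hR hP (G := (2 * η)⁻¹ • 1) (by simp [IsHermitian]) ?_ ?_
  · rw [npgStep, sub_sub_cancel_left, Matrix.smul_mul, Matrix.one_mul, smul_neg, neg_neg, smul_smul,
      inv_mul_cancel₀ (by positivity), one_smul]
  · have hh : ‖hess B D R γ P‖ ≤ (2 * η)⁻¹ := by
      -- For a vanishing norm the step size bound has the junk value `0`.
      rcases (norm_nonneg (hess B D R γ P)).eq_or_lt with h0 | h0
      · rw [← h0]; positivity
      · rw [le_div_iff₀ (by positivity)] at hη'
        rw [← one_div, le_div_iff₀ (by positivity)]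
        linarith
    refine posDef_of_qf (ε := (2 * η)⁻¹) ?_ (by positivity) fun v => ?_
    · refine IsHermitian.sub (by simp [IsHermitian]) (hess_posDef hR hp hg).isHermitian
    · rw [qf_sub, two_nsmul, qf_add, qf_smul_one]
      have h1 := qf_le_norm_mul_nsq (hess B D R γ P) v
      have h2 := mul_le_mul_of_nonneg_right hh (nsq_nonneg v)
      linarith

lemma gaussNewtonStep_mem_feasibleSet (hγ : 0 < γ) (hR : R.PosDef)
    (hP : IsStabilizingSolution A B C D R γ K P) {η : ℝ} (hη : 0 < η) (hη' : η ≤ 1 / 2) :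
    gaussNewtonStep A B D R γ P η K ∈ feasibleSet A B C D R γ := by
  obtain ⟨hp, hg, -, -⟩ := (isStabilizingSolution_iff hγ).1 hP
  have hH := hess_posDef (B := B) hR hp hg
  refine mem_feasibleSet_of_gradE hγ hR hP (G := (2 * η)⁻¹ • hess B D R γ P) ?_ ?_ ?_
  · simp [IsHermitian, transpose_eq_of_isHermitian hH.isHermitian]
  · have hu := (isUnit_iff_isUnit_det _).1 hH.isUnit
    rw [gaussNewtonStep, sub_sub_cancel_left, Matrix.smul_mul, Matrix.mul_neg, Matrix.mul_smul,
      ← Matrix.mul_assoc, mul_nonsing_inv _ hu, Matrix.one_mul, smul_neg, neg_neg, smul_smul,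
      inv_mul_cancel₀ (by positivity), one_smul]
  · have h1 : 2 • ((2 * η)⁻¹ • hess B D R γ P) - hess B D R γ P
        = (η⁻¹ - 1) • hess B D R γ P := by
      rw [two_nsmul, ← add_smul, sub_smul, one_smul]
      congr 2
      field_simp
      norm_num
    rw [h1]
    refine hH.smul (sub_pos.2 ?_)
    exact (one_lt_inv₀ hη).2 (by linarith)

end Design

/-! ### Finite Fourier transform -/

section Parseval

variable {ι : Type*} [Fintype ι] {ζ : ℂ} {N : ℕ}

/-- Orthogonality of the characters `k ↦ ζ ^ (k s)`. -/
lemma sum_pow_mul_inv_pow (hζ : IsPrimitiveRoot ζ N) {s t : ℕ} (hs : s < N) (ht : t < N) :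
    ∑ k ∈ Finset.range N, ζ ^ (k * s) * ζ⁻¹ ^ (k * t) = if s = t then (N : ℂ) else 0 := by
  have hN : N ≠ 0 := by omega
  have hζ0 : ζ ≠ 0 := hζ.ne_zero hN
  have h1 : ∀ k, ζ ^ (k * s) * ζ⁻¹ ^ (k * t) = (ζ ^ s * ζ⁻¹ ^ t) ^ k := fun k => by
    rw [mul_pow, ← pow_mul, ← pow_mul, mul_comm s, mul_comm t]
  simp only [h1]
  split_ifs with h
  · subst h
    simp only [inv_pow, mul_inv_cancel₀ (pow_ne_zero s hζ0), one_pow]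
    simp
  · have hne : ζ ^ s * ζ⁻¹ ^ t ≠ 1 := by
      intro h2
      rw [inv_pow, mul_inv_eq_one₀ (pow_ne_zero _ hζ0)] at h2
      exact h (hζ.pow_inj hs ht h2)
    have h3 : (ζ ^ s * ζ⁻¹ ^ t) ^ N = 1 := by
      rw [mul_pow, ← pow_mul, ← pow_mul, mul_comm s, mul_comm t, pow_mul, pow_mul, inv_pow,
        hζ.pow_eq_one]
      simp
    have h4 := geom_sum_mul (ζ ^ s * ζ⁻¹ ^ t) N
    rw [h3, sub_self] at h4
    exact (mul_eq_zero.1 h4).resolve_right (sub_ne_zero.2 hne)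

lemma norm_sq_sum_pow (hζ : IsPrimitiveRoot ζ N) (a : ℕ → ℂ) :
    ∑ t ∈ Finset.range N, ‖∑ k ∈ Finset.range N, ζ ^ (t * k) * a k‖ ^ 2
      = N * ∑ k ∈ Finset.range N, ‖a k‖ ^ 2 := by
  rcases Nat.eq_zero_or_pos N with rfl | hN
  · simp
  have hconj : (starRingEnd ℂ) ζ = ζ⁻¹ := by
    rw [Complex.inv_def, Complex.normSq_eq_norm_sq, hζ.norm'_eq_one hN.ne']
    simp
  have key : ∀ t, (((‖∑ k ∈ Finset.range N, ζ ^ (t * k) * a k‖ ^ 2 : ℝ)) : ℂ)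
      = ∑ k ∈ Finset.range N, ∑ l ∈ Finset.range N,
        (ζ ^ (t * k) * ζ⁻¹ ^ (t * l)) * (a k * (starRingEnd ℂ) (a l)) := fun t => by
    rw [Complex.ofReal_pow, ← Complex.mul_conj', map_sum, Finset.sum_mul_sum]
    refine Finset.sum_congr rfl fun k _ => Finset.sum_congr rfl fun l _ => ?_
    rw [map_mul, map_pow, hconj]
    ring
  have : (((∑ t ∈ Finset.range N, ‖∑ k ∈ Finset.range N, ζ ^ (t * k) * a k‖ ^ 2 : ℝ)) : ℂ)
      = ((N * ∑ k ∈ Finset.range N, ‖a k‖ ^ 2 : ℝ) : ℂ) := by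
    rw [Complex.ofReal_sum, Finset.sum_congr rfl fun t _ => key t, Finset.sum_comm]
    have : ∀ k ∈ Finset.range N, ∑ t ∈ Finset.range N, ∑ l ∈ Finset.range N,
        (ζ ^ (t * k) * ζ⁻¹ ^ (t * l)) * (a k * (starRingEnd ℂ) (a l))
        = N * (‖a k‖ ^ 2 : ℝ) := fun k hk => by
      rw [Finset.sum_comm]
      simp only [← Finset.sum_mul]
      rw [Finset.sum_congr rfl fun l hl => by
        rw [sum_pow_mul_inv_pow hζ (Finset.mem_range.1 hk) (Finset.mem_range.1 hl)]]
      simp only [ite_mul, zero_mul]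
      rw [Finset.sum_ite_eq, if_pos hk, Complex.mul_conj', Complex.ofReal_pow]
    rw [Finset.sum_congr rfl this, ← Finset.mul_sum]
    push_cast
    rfl
  exact_mod_cast this

/-- Parseval's identity for the discrete Fourier transform of vector-valued sequences. -/
lemma nsq_sum_pow (hζ : IsPrimitiveRoot ζ N) (a : ℕ → ι → ℂ) :
    ∑ t ∈ Finset.range N, nsq (∑ k ∈ Finset.range N, ζ ^ (t * k) • a k)
      = N * ∑ k ∈ Finset.range N, nsq (a k) := by
  simp only [nsq, Finset.sum_apply, Pi.smul_apply, smul_eq_mul]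
  rw [Finset.sum_comm, Finset.sum_comm (s := Finset.range N), Finset.mul_sum]
  exact Finset.sum_congr rfl fun i _ => norm_sq_sum_pow hζ fun k => a k i

lemma inverse_transform (hζ : IsPrimitiveRoot ζ N) (u : ℕ → ι → ℂ) {t : ℕ} (ht : t < N) :
    ∑ k ∈ Finset.range N, ζ ^ (t * k) • ∑ s ∈ Finset.range N, ζ⁻¹ ^ (k * s) • u s
      = (N : ℂ) • u t := by
  simp only [Finset.smul_sum, smul_smul]
  rw [Finset.sum_comm]
  simp only [← Finset.sum_smul, mul_comm t]
  rw [Finset.sum_congr rfl fun s hs => by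
    rw [sum_pow_mul_inv_pow hζ ht (Finset.mem_range.1 hs)]]
  simp only [ite_smul, zero_smul]
  rw [Finset.sum_ite_eq, if_pos (Finset.mem_range.2 ht)]

end Parseval

/-! ### From the frequency domain to the time domain -/

section Dissipation

variable {m n : Type*} [Fintype m] [DecidableEq m] [Fintype n] [DecidableEq n]

/-- `x` is a state trajectory of the system `x_{t+1} = F x_t + D u_t` with input `u`. -/
def IsTrajectory {𝕜 : Type*} [RCLike 𝕜] (F : Matrix m m 𝕜) (D : Matrix m n 𝕜) (x : ℕ → m → 𝕜)
    (u : ℕ → n → 𝕜) : Prop :=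
  ∀ t, x (t + 1) = F *ᵥ x t + D *ᵥ u t

/-- Over one period, any input has a periodic response, and the energy gain of the response is at
most the supremum of the transfer function over the unit circle. The response is synthesized
frequency by frequency at the `N`-th roots of unity. -/
lemma exists_periodic_response {F : Matrix m m ℝ} (hF : rho F < 1) (D : Matrix m n ℝ) {N : ℕ}
    (hN : N ≠ 0) (u : ℕ → n → ℂ) : ∃ ξ : ℕ → m → ℂ,
      (∀ t < N, ξ (t + 1) = toC F *ᵥ ξ t + toC D *ᵥ u t) ∧ ξ N = ξ 0 ∧
      ∀ (X : Matrix m m ℝ) (c : ℝ), (∀ z : ℂ, ‖z‖ = 1 → ‖transferFunction F D X 0 z‖ ≤ c) →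
        ∑ t ∈ Finset.range N, nsq (toC X *ᵥ ξ t) ≤ c ^ 2 * ∑ t ∈ Finset.range N, nsq (u t) := by
  set ζ := Complex.exp (2 * Real.pi * Complex.I / N)
  have hζ : IsPrimitiveRoot ζ N := Complex.isPrimitiveRoot_exp N hN
  have hnorm : ∀ k, ‖ζ ^ k‖ = 1 := fun k => by rw [norm_pow, hζ.norm'_eq_one hN, one_pow]
  have hNC : (N : ℂ) ≠ 0 := Nat.cast_ne_zero.2 hN
  set û : ℕ → n → ℂ := fun k => ∑ s ∈ Finset.range N, ζ⁻¹ ^ (k * s) • u s with hû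
  set r : ℕ → m → ℂ := fun k => (ζ ^ k • (1 : Matrix m m ℂ) - toC F)⁻¹ *ᵥ (toC D *ᵥ û k) with hr
  refine ⟨fun t => (N : ℂ)⁻¹ • ∑ k ∈ Finset.range N, ζ ^ (t * k) • r k, ?_, ?_, ?_⟩
  · intro t ht
    have h1 : ∀ k, ζ ^ ((t + 1) * k) • r k
        = toC F *ᵥ (ζ ^ (t * k) • r k) + toC D *ᵥ (ζ ^ (t * k) • û k) := fun k => by
      rw [add_mul, one_mul, pow_add, mul_smul, hr, resolvent_mulVec hF (hnorm k), smul_add,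
        mulVec_smul, mulVec_smul]
    simp only [h1]
    rw [Finset.sum_add_distrib, ← mulVec_sum, ← mulVec_sum, inverse_transform hζ u ht, smul_add,
      mulVec_smul, mulVec_smul, smul_smul, inv_mul_cancel₀ hNC, one_smul]
  · simp [pow_mul, hζ.pow_eq_one]
  · intro X c hc
    have h1 : ∀ t, toC X *ᵥ ((N : ℂ)⁻¹ • ∑ k ∈ Finset.range N, ζ ^ (t * k) • r k)
        = (N : ℂ)⁻¹ • ∑ k ∈ Finset.range N, ζ ^ (t * k) • (toC X *ᵥ r k) := fun t => by
      rw [mulVec_smul, mulVec_sum]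
      simp only [mulVec_smul]
    have h2 : ∀ k, nsq (toC X *ᵥ r k) ≤ c ^ 2 * nsq (û k) := fun k => by
      have := nsq_mulVec_le (transferFunction F D X 0 (ζ ^ k)) (û k)
      rw [transferFunction_zero_mulVec] at this
      refine this.trans ?_
      gcongr
      · exact nsq_nonneg _
      · exact hc _ (hnorm k)
    simp only [h1, nsq_smul]
    rw [← Finset.mul_sum, nsq_sum_pow hζ]
    have h3 : ∑ k ∈ Finset.range N, nsq (û k) = N * ∑ t ∈ Finset.range N, nsq (u t) :=
      nsq_sum_pow hζ.inv u
    calc _ ≤ ‖(N : ℂ)⁻¹‖ ^ 2 * (N * ∑ k ∈ Finset.range N, c ^ 2 * nsq (û k)) := by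
          gcongr with k _
          exact h2 k
      _ = _ := by
          rw [← Finset.mul_sum, h3, norm_inv, Complex.norm_natCast]
          have : (N : ℝ) ≠ 0 := Nat.cast_ne_zero.2 hN
          field_simp

lemma exists_angle {z : ℂ} (hz : ‖z‖ = 1) :
    ∃ θ ∈ Set.Ico (0 : ℝ) (2 * Real.pi), Complex.exp (Complex.I * (θ : ℂ)) = z := by
  have h := Complex.norm_mul_exp_arg_mul_I z
  rw [hz, Complex.ofReal_one, one_mul] at h
  rcases le_or_gt 0 z.arg with h0 | h0
  · exact ⟨z.arg, ⟨h0, by linarith [Complex.arg_le_pi z, Real.pi_pos]⟩, by rw [mul_comm, h]⟩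
  · refine ⟨z.arg + 2 * Real.pi, ⟨by linarith [Complex.neg_pi_lt_arg z], by linarith⟩, ?_⟩
    push_cast
    rw [mul_add, Complex.exp_add, mul_comm Complex.I (2 * _), Complex.exp_two_pi_mul_I, mul_one,
      mul_comm, h]

lemma exists_norm_transferFunction_le {F : Matrix m m ℝ} (hF : rho F < 1) (D : Matrix m n ℝ)
    (X : Matrix m m ℝ) : ∃ c : ℝ, ∀ z : ℂ, ‖z‖ = 1 → ‖transferFunction F D X 0 z‖ ≤ c := by
  obtain ⟨c, hc⟩ := (isCompact_Icc (a := (0 : ℝ)) (b := 2 * Real.pi)).exists_bound_of_continuousOn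
    (continuous_transferFunction hF D X).continuousOn
  refine ⟨c, fun z hz => ?_⟩
  obtain ⟨θ, hθ, rfl⟩ := exists_angle hz
  exact hc θ ⟨hθ.1, hθ.2.le⟩

lemma trajectory_zero_input {F : Matrix m m ℂ} {x : ℕ → m → ℂ} {T : ℕ}
    (h : ∀ t < T, x (t + 1) = F *ᵥ x t) : ∀ t ≤ T, x t = F ^ t *ᵥ x 0 := by
  intro t
  induction t with
  | zero => simp
  | succ t ih =>
    intro ht
    rw [h t (by omega), ih (by omega), mulVec_mulVec, pow_succ']

/-- A frequency-domain gain bound gives the time-domain gain bound on every finite horizon. The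
input, cut off after time `T`, is made periodic with period `N`; as `N → ∞` the initial state of the
periodic response decays, so the response converges to the trajectory started at rest. -/
lemma sum_nsq_le_of_zero_initial {F : Matrix m m ℝ} (hF : rho F < 1) {D : Matrix m n ℝ}
    {X : Matrix m m ℝ} {c : ℝ} (hc : ∀ z : ℂ, ‖z‖ = 1 → ‖transferFunction F D X 0 z‖ ≤ c)
    {x : ℕ → m → ℂ} {u : ℕ → n → ℂ} (hx : IsTrajectory (toC F) (toC D) x u) (hx0 : x 0 = 0)
    (T : ℕ) :
    ∑ t ∈ Finset.range T, nsq (toC X *ᵥ x t) ≤ c ^ 2 * ∑ t ∈ Finset.range T, nsq (u t) := by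
  obtain ⟨b, hb⟩ := exists_norm_transferFunction_le hF D 1
  set v : ℕ → n → ℂ := fun t => if t < T then u t else 0 with hv
  have hvsum : ∀ j,
      ∑ t ∈ Finset.range (T + j + 1), nsq (v t) = ∑ t ∈ Finset.range T, nsq (u t) := by
    intro j
    rw [add_assoc, Finset.sum_range_add]
    have h1 : ∑ t ∈ Finset.range T, nsq (v t) = ∑ t ∈ Finset.range T, nsq (u t) :=
      Finset.sum_congr rfl fun t ht => by simp [hv, Finset.mem_range.1 ht]
    have h2 : ∑ t ∈ Finset.range (j + 1), nsq (v (T + t)) = 0 :=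
      Finset.sum_eq_zero fun t _ => by simp [hv]
    rw [h1, h2, add_zero]
  choose ξ hξ hper hgain using fun j : ℕ =>
    exists_periodic_response hF D (N := T + j + 1) (by omega) v
  set E := b ^ 2 * ∑ t ∈ Finset.range T, nsq (u t) with hE
  -- The state at time `T` is bounded independently of the period, by the gain bound for the state
  -- as output.
  have hE0 : ∀ j, nsq (ξ j T) ≤ E := fun j => by
    have h1 := hgain j 1 b hb
    rw [hvsum, ← hE] at h1
    simp only [toC_one, one_mulVec] at h1
    exact (Finset.single_le_sum (fun t _ => nsq_nonneg (ξ j t))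
      (Finset.mem_range.2 (by omega))).trans h1
  -- After time `T` the input is zero until the period closes, so the state decays.
  have hinit : ∀ j, ξ j 0 = toC F ^ (j + 1) *ᵥ ξ j T := fun j => by
    have h1 := trajectory_zero_input (F := toC F) (x := fun t => ξ j (T + t)) (T := j + 1)
      (fun t ht => by
        have := hξ j (T + t) (by omega)
        simpa [hv, add_assoc] using this) (j + 1) le_rfl
    rw [← hper j]
    exact h1
  have hξx : ∀ j, ∀ t ≤ T, ξ j t = x t + toC F ^ t *ᵥ ξ j 0 := fun j t ht => by
    have h1 := trajectory_zero_input (F := toC F) (x := fun t => ξ j t - x t) (T := T)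
      (fun t ht => by
        have h2 := hξ j t (by omega)
        simp only [hv, if_pos ht] at h2
        rw [h2, hx t, mulVec_sub]
        abel) t ht
    rw [hx0, sub_zero, sub_eq_iff_eq_add] at h1
    rw [h1, add_comm]
  have hlim0 : Tendsto (fun j => ξ j 0) atTop (𝓝 0) := by
    have h1 : Tendsto (fun j => ‖toC F ^ (j + 1)‖ ^ 2 * E) atTop (𝓝 0) := by
      have := ((tendsto_add_atTop_iff_nat 1).2 (summable_norm_pow hF).tendsto_atTop_zero)
      simpa using (this.pow 2).mul_const E
    have h2 : Tendsto (fun j => nsq (ξ j 0)) atTop (𝓝 0) := by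
      refine squeeze_zero (fun j => nsq_nonneg _) (fun j => ?_) h1
      rw [hinit j]
      refine (nsq_mulVec_le _ _).trans ?_
      gcongr
      exact hE0 j
    rw [tendsto_pi_nhds]
    intro i
    rw [Pi.zero_apply, tendsto_zero_iff_norm_tendsto_zero]
    have h3 : Tendsto (fun j => Real.sqrt (nsq (ξ j 0))) atTop (𝓝 0) := by
      simpa using h2.sqrt
    refine squeeze_zero (fun j => norm_nonneg _) (fun j => ?_) h3
    refine Real.le_sqrt_of_sq_le ?_
    exact Finset.single_le_sum (f := fun i => ‖ξ j 0 i‖ ^ 2) (fun _ _ => by positivity)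
      (Finset.mem_univ i)
  have hlim : Tendsto (fun j => ∑ t ∈ Finset.range T, nsq (toC X *ᵥ ξ j t)) atTop
      (𝓝 (∑ t ∈ Finset.range T, nsq (toC X *ᵥ x t))) := by
    refine tendsto_finsetSum _ fun t ht => ?_
    have hcont : Continuous fun y : m → ℂ => nsq (toC X *ᵥ (x t + toC F ^ t *ᵥ y)) := by
      unfold nsq
      fun_prop
    have h1 := (hcont.tendsto 0).comp hlim0
    simp only [mulVec_zero, add_zero] at h1
    refine h1.congr fun j => ?_
    simp only [Function.comp_apply]
    rw [hξx j t (Finset.mem_range.1 ht).le]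
  refine le_of_tendsto' hlim fun j => ?_
  have h1 := hgain j X c hc
  rw [hvsum] at h1
  refine le_trans ?_ h1
  exact Finset.sum_le_sum_of_subset_of_nonneg (Finset.range_mono (by omega))
    fun t _ _ => nsq_nonneg _

/-- Strict dissipativity: if the `H_∞` norm is below `γ`, the energy of the output exceeds
`γ² - ε` times the energy of the input by at most a multiple of the squared initial state, uniformly
in the horizon. -/
lemma exists_dissipation {F : Matrix m m ℝ} (hF : rho F < 1) {D : Matrix m n ℝ}
    {X : Matrix m m ℝ} {γ : ℝ} (hγ : 0 < γ)
    (h : hInfNorm (transferFunction F D X 0) < ENNReal.ofReal γ) :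
    ∃ ε > 0, ∃ c ≥ 0, ∀ (x : ℕ → m → ℝ) (u : ℕ → n → ℝ), IsTrajectory F D x u → ∀ T,
      ∑ t ∈ Finset.range T, (nsq (X *ᵥ x t) - γ ^ 2 * nsq (u t))
        ≤ c * nsq (x 0) - ε * ∑ t ∈ Finset.range T, nsq (u t) := by
  obtain ⟨g, hg0, hgγ, hg⟩ : ∃ g : ℝ, 0 ≤ g ∧ g < γ ∧
      ∀ z : ℂ, ‖z‖ = 1 → ‖transferFunction F D X 0 z‖ ≤ g := by
    refine ⟨(hInfNorm (transferFunction F D X 0)).toReal, ENNReal.toReal_nonneg, ?_, ?_⟩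
    · exact (ENNReal.lt_ofReal_iff_toReal_lt h.ne_top).1 h
    · intro z hz
      obtain ⟨θ, hθ, rfl⟩ := exists_angle hz
      rw [← ENNReal.ofReal_le_ofReal_iff ENNReal.toReal_nonneg, ENNReal.ofReal_toReal h.ne_top,
        ofReal_norm]
      exact le_iSup₂ (f := fun θ (_ : θ ∈ Set.Ico (0 : ℝ) (2 * Real.pi)) =>
        ‖transferFunction F D X 0 (Complex.exp (Complex.I * (θ : ℂ)))‖ₑ) θ hθ
  have hgap : 0 < γ ^ 2 - g ^ 2 := by nlinarith
  -- Half of the margin `γ² - g²` pays for the cross term with the free response `F ^ t x₀`; the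
  -- other half is `ε`.
  set δ := (γ ^ 2 - g ^ 2) / (2 * (g ^ 2 + 1)) with hδ
  have hδ0 : 0 < δ := by positivity
  have hδg : δ * g ^ 2 ≤ (γ ^ 2 - g ^ 2) / 2 := by
    have h1 : δ * (g ^ 2 + 1) = (γ ^ 2 - g ^ 2) / 2 := by
      rw [hδ]; field_simp
    nlinarith
  set s := ∑' k : ℕ, ‖toC F ^ k‖ with hs
  have hs0 : 0 ≤ s := tsum_nonneg fun _ => norm_nonneg _
  have hsum := summable_norm_pow (M := toC F) hF
  refine ⟨(γ ^ 2 - g ^ 2) / 2, by positivity, (1 + δ⁻¹) * (‖toC X‖ ^ 2 * s ^ 2), by positivity,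
    fun x u hx T => ?_⟩
  set x' : ℕ → m → ℂ := fun t i => (x t i : ℂ) with hx'
  set u' : ℕ → n → ℂ := fun t i => (u t i : ℂ) with hu'
  have htraj : IsTrajectory (toC F) (toC D) x' u' := fun t => by
    simp only [hx', hu', toC_mulVec_ofReal, hx t]
    ext i; simp
  -- The forced response, which starts at rest.
  set y : ℕ → m → ℂ := fun t => x' t - toC F ^ t *ᵥ x' 0 with hy
  have hytraj : IsTrajectory (toC F) (toC D) y u' := fun t => by
    simp only [hy, htraj t, mulVec_sub, mulVec_mulVec, ← pow_succ']
    abel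
  have h1 := sum_nsq_le_of_zero_initial hF hg hytraj (by simp [hy]) T
  have h2 : ∀ t, nsq (X *ᵥ x t) ≤ (1 + δ) * nsq (toC X *ᵥ y t)
      + (1 + δ⁻¹) * (‖toC X‖ ^ 2 * (s * ‖toC F ^ t‖ * nsq (x 0))) := fun t => by
    have e1 : nsq (X *ᵥ x t) = nsq (toC X *ᵥ y t + toC X *ᵥ (toC F ^ t *ᵥ x' 0)) := by
      rw [← mulVec_add, ← nsq_ofReal, ← toC_mulVec_ofReal]
      simp [hy, hx']
    rw [e1]
    refine (nsq_add_le hδ0 _ _).trans ?_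
    gcongr
    refine (nsq_mulVec_le _ _).trans ?_
    gcongr
    refine (nsq_mulVec_le _ _).trans ?_
    have e2 : nsq (x' 0) = nsq (x 0) := nsq_ofReal _
    rw [e2, pow_two]
    have e3 : ‖toC F ^ t‖ ≤ s := hsum.le_tsum t fun _ _ => norm_nonneg _
    have := nsq_nonneg (x 0)
    gcongr
  have h3 : ∑ t ∈ Finset.range T, ‖toC F ^ t‖ ≤ s :=
    hsum.sum_le_tsum _ fun _ _ => norm_nonneg _
  have h4 : ∀ t, nsq (u' t) = nsq (u t) := fun t => nsq_ofReal _
  simp only [h4] at h1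
  have h5 := Finset.sum_le_sum fun t (_ : t ∈ Finset.range T) => h2 t
  rw [Finset.sum_add_distrib, ← Finset.mul_sum, ← Finset.mul_sum, ← Finset.mul_sum,
    ← Finset.sum_mul, ← Finset.mul_sum] at h5
  have h6 : s * (∑ t ∈ Finset.range T, ‖toC F ^ t‖) * nsq (x 0) ≤ s ^ 2 * nsq (x 0) := by
    rw [pow_two]
    have := nsq_nonneg (x 0)
    gcongr
  have h7 : (1 + δ⁻¹) * (‖toC X‖ ^ 2 * (s * (∑ t ∈ Finset.range T, ‖toC F ^ t‖) * nsq (x 0)))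
      ≤ (1 + δ⁻¹) * (‖toC X‖ ^ 2 * (s ^ 2 * nsq (x 0))) := by gcongr
  have h8 := mul_le_mul_of_nonneg_left h1 (by positivity : 0 ≤ 1 + δ)
  have h9 := mul_le_mul_of_nonneg_right hδg
    (Finset.sum_nonneg fun t (_ : t ∈ Finset.range T) => nsq_nonneg (u t))
  rw [Finset.sum_sub_distrib, ← Finset.mul_sum]
  nlinarith

end Dissipation

/-! ### Monotone limits of symmetric matrices -/

section MonotoneLimit

variable {m : Type*} [Fintype m] [DecidableEq m]

/-- Polarization: the entries of a symmetric matrix are determined by its quadratic form. -/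
lemma entry_eq_qf {P : Matrix m m ℝ} (hP : P.IsHermitian) (i j : m) :
    P i j = (qf P (Pi.single i 1 + Pi.single j 1) - qf P (Pi.single i 1)
      - qf P (Pi.single j 1)) / 2 := by
  have h : P j i = P i j := by simpa using hP.apply i j
  simp only [qf, star_trivial, mulVec_add, add_dotProduct, dotProduct_add, mulVec_single_one,
    single_one_dotProduct, col_apply, RCLike.re_to_real, h]
  ring

lemma continuous_qf (v : m → ℝ) : Continuous fun P : Matrix m m ℝ => qf P v := by
  simp only [qf, RCLike.re_to_real]
  exact continuous_const.dotProduct (continuous_id.matrix_mulVec continuous_const)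

/-- A monotone sequence of real symmetric matrices that is bounded above converges. -/
lemma exists_tendsto_of_monotone {P : ℕ → Matrix m m ℝ} (hP : ∀ k, (P k).IsHermitian)
    (hmono : ∀ k v, qf (P k) v ≤ qf (P (k + 1)) v) {b : (m → ℝ) → ℝ}
    (hb : ∀ k v, qf (P k) v ≤ b v) : ∃ L, Tendsto P atTop (𝓝 L) := by
  have h1 : ∀ v, ∃ q, Tendsto (fun k => qf (P k) v) atTop (𝓝 q) := fun v =>
    ⟨_, tendsto_atTop_ciSup (monotone_nat_of_le_succ fun k => hmono k v)
      ⟨b v, by rintro _ ⟨k, rfl⟩; exact hb k v⟩⟩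
  choose q hq using h1
  refine ⟨Matrix.of fun i j => (q (Pi.single i 1 + Pi.single j 1) - q (Pi.single i 1)
      - q (Pi.single j 1)) / 2, ?_⟩
  refine tendsto_pi_nhds.2 fun i => tendsto_pi_nhds.2 fun j => ?_
  simp only [fun k => entry_eq_qf (hP k) i j, of_apply]
  exact (((hq _).sub (hq _)).sub (hq _)).div_const 2

end MonotoneLimit

/-! ### Value iteration for the worst-case disturbance -/

section ValueIteration

variable {m n p : Type*} [Fintype m] [DecidableEq m] [Fintype n] [DecidableEq n] [Fintype p]
  {F : Matrix m m ℝ} {D : Matrix m n ℝ} {X : Matrix p m ℝ} {γ : ℝ} {P : Matrix m m ℝ}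

/-- Prepend a term to a sequence. -/
def seqCons {α : Type*} (a : α) (x : ℕ → α) : ℕ → α
  | 0 => a
  | t + 1 => x t

lemma IsTrajectory.seqCons {x : ℕ → m → ℝ} {u : ℕ → n → ℝ} (h : IsTrajectory F D x u) {a : m → ℝ}
    {b : n → ℝ} (h0 : x 0 = F *ᵥ a + D *ᵥ b) :
    IsTrajectory F D (MixedDesign.seqCons a x) (MixedDesign.seqCons b u) := by
  intro t
  cases t with
  | zero => exact h0
  | succ t => exact h t

/-- The payoff `∑_{t < T} |X x_t|² - γ² |u_t|²` of the disturbance over the horizon `T`. -/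
def payoff (X : Matrix p m ℝ) (γ : ℝ) (x : ℕ → m → ℝ) (u : ℕ → n → ℝ) (T : ℕ) : ℝ :=
  ∑ t ∈ Finset.range T, (nsq (X *ᵥ x t) - γ ^ 2 * nsq (u t))

lemma payoff_seqCons (x : ℕ → m → ℝ) (u : ℕ → n → ℝ) (a : m → ℝ) (b : n → ℝ) (T : ℕ) :
    payoff X γ (seqCons a x) (seqCons b u) (T + 1)
      = payoff X γ x u T + (nsq (X *ᵥ a) - γ ^ 2 * nsq b) := by
  rw [payoff, Finset.sum_range_succ']; rfl

/-- The Riccati operator `P ↦ Fᵀ P̃ F + Xᵀ X`. -/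
def riccatiMap (F : Matrix m m ℝ) (D : Matrix m n ℝ) (X : Matrix p m ℝ) (γ : ℝ)
    (P : Matrix m m ℝ) : Matrix m m ℝ :=
  Fᵀ * tildeP D γ P * F + Xᵀ * X

lemma riccatiMap_isHermitian (hP : P.IsHermitian) : (riccatiMap F D X γ P).IsHermitian := by
  have h := transpose_eq_of_isHermitian (tildeP_isHermitian (D := D) (γ := γ) hP)
  rw [IsHermitian, conjTranspose_eq_transpose_of_trivial, riccatiMap]
  simp only [transpose_add, transpose_mul, transpose_transpose, h, Matrix.mul_assoc]

lemma qf_riccatiMap (a : m → ℝ) :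
    qf (riccatiMap F D X γ P) a = qf (tildeP D γ P) (F *ᵥ a) + nsq (X *ᵥ a) := by
  rw [riccatiMap, qf_add, ← conjTranspose_eq_transpose_of_trivial,
    ← conjTranspose_eq_transpose_of_trivial, qf_conj, qf_conjTranspose_mul_self]

/-- One step of dynamic programming: no disturbance `b` earns more than the Riccati operator
predicts. -/
lemma le_qf_riccatiMap (hP : P.IsHermitian) (hgap : (gap D γ P).PosDef) (a : m → ℝ) (b : n → ℝ) :
    qf P (F *ᵥ a + D *ᵥ b) + (nsq (X *ᵥ a) - γ ^ 2 * nsq b) ≤ qf (riccatiMap F D X γ P) a := by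
  have h1 := qf_add_mulVec hP hgap (F *ᵥ a) b
  have h2 := qf_nonneg hgap.posSemidef (b - worstGain D γ P *ᵥ F *ᵥ a)
  rw [qf_riccatiMap]
  linarith

/-- The worst-case feedback attains the bound of `le_qf_riccatiMap`. -/
lemma qf_riccatiMap_eq (hP : P.IsHermitian) (hgap : (gap D γ P).PosDef) (a : m → ℝ) :
    qf (riccatiMap F D X γ P) a = qf P (F *ᵥ a + D *ᵥ ((worstGain D γ P * F) *ᵥ a))
      + (nsq (X *ᵥ a) - γ ^ 2 * nsq ((worstGain D γ P * F) *ᵥ a)) := by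
  have h1 := qf_add_mulVec hP hgap (F *ᵥ a) ((worstGain D γ P * F) *ᵥ a)
  rw [mulVec_mulVec (M := worstGain D γ P), sub_self] at h1
  have h0 : qf (gap D γ P) 0 = 0 := by simp [qf]
  rw [h0] at h1
  rw [qf_riccatiMap]
  linarith

/-- Value iteration for the disturbance: `valueIter k` is the matrix of the optimal payoff over the
horizon `k`. -/
def valueIter (F : Matrix m m ℝ) (D : Matrix m n ℝ) (X : Matrix p m ℝ) (γ : ℝ) :
    ℕ → Matrix m m ℝ
  | 0 => 0
  | k + 1 => riccatiMap F D X γ (valueIter F D X γ k)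

variable {ε c : ℝ}

/-- The strict dissipation inequality with constants `ε` and `c`, over every finite horizon. -/
def IsDissipative (F : Matrix m m ℝ) (D : Matrix m n ℝ) (X : Matrix p m ℝ) (γ ε c : ℝ) : Prop :=
  ∀ (x : ℕ → m → ℝ) (u : ℕ → n → ℝ), IsTrajectory F D x u → ∀ T,
    payoff X γ x u T ≤ c * nsq (x 0) - ε * ∑ t ∈ Finset.range T, nsq (u t)

/-- If `qf P` is attained as a payoff over some horizon, then playing `b` from rest and continuing
optimally earns `-b* (γ² - Dᵀ P D) b`; dissipativity bounds this by `-ε |b|²`. -/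
lemma le_qf_gap (hε : 0 < ε) (hdis : IsDissipative F D X γ ε c) {k : ℕ}
    (hatt : ∀ a : m → ℝ, ∃ x, ∃ u : ℕ → n → ℝ, IsTrajectory F D x u ∧ x 0 = a ∧
      payoff X γ x u k = qf P a) (b : n → ℝ) : ε * nsq b ≤ qf (gap D γ P) b := by
  obtain ⟨x, u, hx, hx0, hpay⟩ := hatt (D *ᵥ b)
  have h1 := hdis _ _ (hx.seqCons (a := 0) (b := b) (by simp [hx0])) (k + 1)
  rw [payoff_seqCons, hpay, Finset.sum_range_succ'] at h1
  have h2 : qf (gap D γ P) b = γ ^ 2 * nsq b - qf P (D *ᵥ b) := by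
    rw [gap, qf_sub, qf_smul_one, ← conjTranspose_eq_transpose_of_trivial, qf_conj]
  have h3 : 0 ≤ ε * ∑ t ∈ Finset.range k, nsq (seqCons b u (t + 1)) :=
    mul_nonneg hε.le (Finset.sum_nonneg fun _ _ => nsq_nonneg _)
  simp only [seqCons, mulVec_zero, nsq_zero, mul_zero] at h1 h3
  linarith

lemma valueIter_isHermitian (k : ℕ) : (valueIter F D X γ k).IsHermitian := by
  induction k with
  | zero => exact isHermitian_zero
  | succ k ih => exact riccatiMap_isHermitian ih

lemma valueIter_attained (hε : 0 < ε) (hdis : IsDissipative F D X γ ε c) (k : ℕ) :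
    ∀ a : m → ℝ, ∃ x, ∃ u : ℕ → n → ℝ, IsTrajectory F D x u ∧ x 0 = a ∧
      payoff X γ x u k = qf (valueIter F D X γ k) a := by
  induction k with
  | zero =>
    intro a
    refine ⟨fun t => F ^ t *ᵥ a, 0, fun t => ?_, by simp, by simp [payoff, valueIter, qf]⟩
    simp [mulVec_mulVec, pow_succ']
  | succ k ih =>
    intro a
    have hgap : (gap D γ (valueIter F D X γ k)).PosDef :=
      posDef_of_qf (gap_isHermitian (valueIter_isHermitian k)) hε (le_qf_gap hε hdis ih)
    obtain ⟨x, u, hx, hx0, hpay⟩ := ih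
      (F *ᵥ a + D *ᵥ ((worstGain D γ (valueIter F D X γ k) * F) *ᵥ a))
    refine ⟨_, _, hx.seqCons hx0, rfl, ?_⟩
    rw [payoff_seqCons, hpay, valueIter, qf_riccatiMap_eq (valueIter_isHermitian k) hgap]

lemma le_qf_gap_valueIter (hε : 0 < ε) (hdis : IsDissipative F D X γ ε c) (k : ℕ) (b : n → ℝ) :
    ε * nsq b ≤ qf (gap D γ (valueIter F D X γ k)) b :=
  le_qf_gap hε hdis (valueIter_attained hε hdis k) b

lemma gap_valueIter_posDef (hε : 0 < ε) (hdis : IsDissipative F D X γ ε c) (k : ℕ) :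
    (gap D γ (valueIter F D X γ k)).PosDef :=
  posDef_of_qf (gap_isHermitian (valueIter_isHermitian k)) hε (le_qf_gap_valueIter hε hdis k)

lemma qf_valueIter_le (hε : 0 < ε) (hdis : IsDissipative F D X γ ε c) (k : ℕ) (a : m → ℝ) :
    qf (valueIter F D X γ k) a ≤ c * nsq a := by
  obtain ⟨x, u, hx, rfl, hpay⟩ := valueIter_attained hε hdis k a
  rw [← hpay]
  have h1 : 0 ≤ ε * ∑ t ∈ Finset.range k, nsq (u t) :=
    mul_nonneg hε.le (Finset.sum_nonneg fun _ _ => nsq_nonneg _)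
  linarith [hdis x u hx k]

lemma qf_valueIter_mono (hε : 0 < ε) (hdis : IsDissipative F D X γ ε c) (k : ℕ) :
    ∀ a : m → ℝ, qf (valueIter F D X γ k) a ≤ qf (valueIter F D X γ (k + 1)) a := by
  induction k with
  | zero =>
    intro a
    have h := le_qf_riccatiMap (F := F) (X := X) (valueIter_isHermitian 0)
      (gap_valueIter_posDef hε hdis 0) a 0
    have h0 : ∀ v, qf (valueIter F D X γ 0) v = 0 := fun v => by simp [valueIter, qf]
    rw [h0, nsq_zero] at h
    rw [h0, valueIter]
    linarith [nsq_nonneg (X *ᵥ a)]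
  | succ k ih =>
    intro a
    rw [valueIter, qf_riccatiMap_eq (valueIter_isHermitian k) (gap_valueIter_posDef hε hdis k)]
    have h1 := le_qf_riccatiMap (F := F) (X := X) (valueIter_isHermitian (k + 1))
      (gap_valueIter_posDef hε hdis (k + 1)) a
      ((worstGain D γ (valueIter F D X γ k) * F) *ᵥ a)
    have h2 := ih (F *ᵥ a + D *ᵥ ((worstGain D γ (valueIter F D X γ k) * F) *ᵥ a))
    rw [valueIter.eq_2 F D X γ (k + 1)]
    linarith

/-- Value iteration converges to a positive semidefinite fixed point of the Riccati operator. -/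
lemma exists_fixedPoint (hε : 0 < ε) (hdis : IsDissipative F D X γ ε c) :
    ∃ P, Tendsto (valueIter F D X γ) atTop (𝓝 P) ∧ P.PosSemidef ∧ (gap D γ P).PosDef ∧
      P = riccatiMap F D X γ P := by
  obtain ⟨P, hP⟩ := exists_tendsto_of_monotone (valueIter_isHermitian (F := F) (D := D) (X := X)
    (γ := γ)) (qf_valueIter_mono hε hdis) (qf_valueIter_le hε hdis)
  have hPt : Pᵀ = P := by
    refine tendsto_nhds_unique ((continuous_id.matrix_transpose.tendsto P).comp hP) (hP.congr ?_)
    exact fun k => (transpose_eq_of_isHermitian (valueIter_isHermitian k)).symm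
  have hPh : P.IsHermitian := by rwa [IsHermitian, conjTranspose_eq_transpose_of_trivial]
  have hpos : ∀ k v, 0 ≤ qf (valueIter F D X γ k) v := fun k v =>
    (by simp [valueIter, qf] : (0 : ℝ) = qf (valueIter F D X γ 0) v).le.trans
      (monotone_nat_of_le_succ (f := fun k => qf (valueIter F D X γ k) v)
        (fun k => qf_valueIter_mono hε hdis k v) (Nat.zero_le k))
  have hpsd : P.PosSemidef := posSemidef_of_qf hPh fun v =>
    ge_of_tendsto' (((continuous_qf v).tendsto P).comp hP) fun k => hpos k v
  have hgapc : Continuous fun P : Matrix m m ℝ => gap D γ P :=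
    continuous_const.sub ((continuous_const.matrix_mul continuous_id).matrix_mul continuous_const)
  have hgap : (gap D γ P).PosDef := posDef_of_qf (gap_isHermitian hPh) hε fun v =>
    ge_of_tendsto' ((((continuous_qf v).comp hgapc).tendsto P).comp hP)
      fun k => le_qf_gap_valueIter hε hdis k v
  have hinv : ContinuousAt (fun P : Matrix m m ℝ => (gap D γ P)⁻¹) P := by
    refine ContinuousAt.comp (f := fun P : Matrix m m ℝ => gap D γ P) ?_ hgapc.continuousAt
    apply continuousAt_matrix_inv
    obtain ⟨e, he⟩ := (isUnit_iff_isUnit_det _).1 hgap.isUnit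
    rw [← he]
    exact NormedRing.inverse_continuousAt e
  -- `γ² I - Dᵀ P D` stays invertible in the limit, so the Riccati operator is continuous there.
  have hric : ContinuousAt (riccatiMap F D X γ) P := by
    have h1 : ContinuousAt (fun P : Matrix m m ℝ => P) P := continuousAt_id
    change ContinuousAt (fun P : Matrix m m ℝ =>
      Fᵀ * (P + P * D * (gap D γ P)⁻¹ * Dᵀ * P) * F + Xᵀ * X) P
    have h2 : Continuous fun p : Matrix m m ℝ × Matrix n n ℝ =>
        Fᵀ * (p.1 + p.1 * D * p.2 * Dᵀ * p.1) * F + Xᵀ * X := by fun_prop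
    exact ContinuousAt.comp (f := fun P : Matrix m m ℝ => (P, (gap D γ P)⁻¹)) h2.continuousAt
      (h1.prodMk hinv)
  exact ⟨P, hP, hpsd, hgap, tendsto_nhds_unique ((tendsto_add_atTop_iff_nat 1).2 hP)
    (hric.tendsto.comp hP)⟩

/-- Play the worst-case feedback of a fixed point `P` for `T` steps, then an optimal disturbance
for the horizon `N`. -/
lemma exists_spliced_trajectory (hε : 0 < ε) (hdis : IsDissipative F D X γ ε c)
    (hP : P.IsHermitian) (hgap : (gap D γ P).PosDef) (hfix : P = riccatiMap F D X γ P) (N T : ℕ) :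
    ∀ a : m → ℝ, ∃ x, ∃ u : ℕ → n → ℝ, IsTrajectory F D x u ∧ x 0 = a ∧
      payoff X γ x u (T + N) = qf P a
        - (qf P (((1 + D * worstGain D γ P) * F) ^ T *ᵥ a)
          - qf (valueIter F D X γ N) (((1 + D * worstGain D γ P) * F) ^ T *ᵥ a)) ∧
      ∑ t ∈ Finset.range T,
          nsq ((worstGain D γ P * F * ((1 + D * worstGain D γ P) * F) ^ t) *ᵥ a)
        ≤ ∑ t ∈ Finset.range (T + N), nsq (u t) := by
  set S := (1 + D * worstGain D γ P) * F with hS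
  have hSa : ∀ a, S *ᵥ a = F *ᵥ a + D *ᵥ ((worstGain D γ P * F) *ᵥ a) := fun a => by
    rw [hS, Matrix.add_mul, Matrix.one_mul, add_mulVec, Matrix.mul_assoc, ← mulVec_mulVec (M := D)]
  induction T with
  | zero =>
    intro a
    obtain ⟨x, u, hx, hx0, hpay⟩ := valueIter_attained hε hdis N a
    refine ⟨x, u, hx, hx0, by simp [hpay], ?_⟩
    simpa using Finset.sum_nonneg fun t _ => nsq_nonneg (u t)
  | succ T ih =>
    intro a
    obtain ⟨x, u, hx, hx0, hpay, hsum⟩ := ih (S *ᵥ a)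
    refine ⟨_, _, hx.seqCons (hx0.trans (hSa a)), rfl, ?_, ?_⟩
    · have h1 : qf P a = _ := (congrArg (fun P => qf P a) hfix).trans
        (qf_riccatiMap_eq (F := F) (X := X) hP hgap a)
      rw [add_right_comm, payoff_seqCons, hpay, h1, mulVec_mulVec, ← pow_succ, hSa]
      ring
    · rw [add_right_comm, Finset.sum_range_succ', Finset.sum_range_succ']
      refine add_le_add ?_ ?_
      · refine le_trans (le_of_eq (Finset.sum_congr rfl fun t _ => ?_)) hsum
        rw [mulVec_mulVec, Matrix.mul_assoc _ (S ^ t) S, ← pow_succ]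
      · simp [seqCons]

/-- The worst-case disturbance of the limit of value iteration has finite energy. -/
lemma sum_nsq_feedback_le (hε : 0 < ε) (hdis : IsDissipative F D X γ ε c)
    (hP : P.PosSemidef) (hgap : (gap D γ P).PosDef) (hfix : P = riccatiMap F D X γ P)
    (hlim : Tendsto (valueIter F D X γ) atTop (𝓝 P)) (T : ℕ) (a : m → ℝ) :
    ε * ∑ t ∈ Finset.range T,
        nsq ((worstGain D γ P * F * ((1 + D * worstGain D γ P) * F) ^ t) *ᵥ a)
      ≤ c * nsq a := by
  set b := ((1 + D * worstGain D γ P) * F) ^ T *ᵥ a with hb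
  set σ := ∑ t ∈ Finset.range T,
        nsq ((worstGain D γ P * F * ((1 + D * worstGain D γ P) * F) ^ t) *ᵥ a) with hσ
  have h1 : ∀ N, qf P a - (qf P b - qf (valueIter F D X γ N) b) ≤ c * nsq a - ε * σ := fun N => by
    obtain ⟨x, u, hx, hx0, hpay, hsum⟩ :=
      exists_spliced_trajectory hε hdis hP.isHermitian hgap hfix N T a
    rw [← hb] at hpay
    rw [← hpay, ← hx0]
    have := mul_le_mul_of_nonneg_left hsum hε.le
    linarith [hdis x u hx (T + N)]
  have h2 : Tendsto (fun N => qf P a - (qf P b - qf (valueIter F D X γ N) b)) atTop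
      (𝓝 (qf P a - (qf P b - qf P b))) :=
    (tendsto_const_nhds.sub (tendsto_const_nhds.sub (((continuous_qf b).tendsto P).comp hlim)))
  have h3 := le_of_tendsto' h2 h1
  -- As `N → ∞` the payoff tends to `qf P a`, which is nonnegative.
  have h4 := qf_nonneg hP a
  linarith

lemma nsq_toC_mulVec (M : Matrix n m ℝ) (v : m → ℂ) :
    nsq (toC M *ᵥ v) = nsq (M *ᵥ fun i => (v i).re) + nsq (M *ᵥ fun i => (v i).im) := by
  simp only [nsq, ← Finset.sum_add_distrib]
  refine Finset.sum_congr rfl fun i _ => ?_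
  rw [← Complex.normSq_eq_norm_sq, Complex.normSq_apply]
  simp [mulVec, dotProduct, pow_two]

/-- The limit of value iteration is a stabilizing solution: along an eigenvector of the worst-case
closed loop with eigenvalue outside the open disc, finite energy of the disturbance forces it to
vanish, so the vector is an eigenvector of the stable matrix `F`. -/
lemma rho_worstCase_lt_one (hF : rho F < 1) (hε : 0 < ε) (hdis : IsDissipative F D X γ ε c)
    (hP : P.PosSemidef) (hgap : (gap D γ P).PosDef) (hfix : P = riccatiMap F D X γ P)
    (hlim : Tendsto (valueIter F D X γ) atTop (𝓝 P)) :
    rho ((1 + D * worstGain D γ P) * F) < 1 := by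
  have hbound := sum_nsq_feedback_le hε hdis hP hgap hfix hlim
  set S := (1 + D * worstGain D γ P) * F with hS
  set L := worstGain D γ P * F with hL
  have hSF : S = F + D * L := by
    rw [hS, hL, Matrix.add_mul, Matrix.one_mul, Matrix.mul_assoc]
  rw [rho_lt_one_iff]
  intro z v hv hz
  by_contra! hz1
  have hpow : ∀ t : ℕ, toC S ^ t *ᵥ v = z ^ t • v := fun t => by
    induction t with
    | zero => simp
    | succ t ih => rw [pow_succ', ← mulVec_mulVec, ih, mulVec_smul, hz, smul_smul, ← pow_succ]
  have h1 : ∀ T : ℕ, T * (ε * nsq (toC L *ᵥ v)) ≤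
      c * nsq (fun i => (v i).re) + c * nsq (fun i => (v i).im) := fun T => by
    refine le_trans ?_ (add_le_add (hbound T _) (hbound T _))
    rw [← mul_add, ← Finset.sum_add_distrib]
    simp only [← nsq_toC_mulVec]
    have h2 : ∀ t ∈ Finset.range T, nsq (toC L *ᵥ v) ≤ nsq (toC (L * S ^ t) *ᵥ v) := fun t _ => by
      rw [toC_mul L, toC_pow, ← mulVec_mulVec, hpow, mulVec_smul, nsq_smul]
      refine le_mul_of_one_le_left (nsq_nonneg _) (one_le_pow₀ ?_)
      rw [norm_pow]
      exact one_le_pow₀ hz1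
    have h3 := Finset.card_nsmul_le_sum _ _ _ h2
    rw [Finset.card_range, nsmul_eq_mul] at h3
    nlinarith
  have hLv : toC L *ᵥ v = 0 := by
    by_contra hne
    have hpos : 0 < ε * nsq (toC L *ᵥ v) :=
      mul_pos hε ((nsq_nonneg _).lt_of_ne fun h => hne (nsq_eq_zero.1 h.symm))
    obtain ⟨T, hT⟩ := Archimedean.arch
      (c * nsq (fun i => (v i).re) + c * nsq (fun i => (v i).im) + 1) hpos
    rw [nsmul_eq_mul] at hT
    linarith [h1 T]
  refine ((rho_lt_one_iff F).1 hF z v hv ?_).not_ge hz1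
  rw [← hz, hSF, toC_add, toC_mul, add_mulVec, ← mulVec_mulVec, hLv, mulVec_zero, add_zero]

end ValueIteration

/-! ### The bounded real lemma -/

section Existence

variable {m d n l : Type*} [Fintype m] [DecidableEq m] [Fintype d] [DecidableEq d]
  [Fintype n] [DecidableEq n] [Fintype l]
  {A : Matrix m m ℝ} {B : Matrix m d ℝ} {C : Matrix l m ℝ} {D : Matrix m n ℝ}
  {R : Matrix d d ℝ} {γ : ℝ} {K : Matrix d m ℝ}

/-- The bounded real lemma: a feasible policy has a stabilizing Riccati solution. -/
lemma exists_stabilizing_of_mem_feasibleSet (hγ : 0 < γ) (hR : R.PosDef)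
    (hK : K ∈ feasibleSet A B C D R γ) : ∃ P, IsStabilizingSolution A B C D R γ K P := by
  obtain ⟨ε, hε, c, -, hdis⟩ := exists_dissipation hK.1 hγ hK.2
  obtain ⟨P, hlim, hpsd, hgap, hfix⟩ := exists_fixedPoint hε hdis
  refine ⟨P, (isStabilizingSolution_iff hγ).2 ⟨hpsd, hgap, ?_,
    rho_worstCase_lt_one hK.1 hε hdis hpsd hgap hfix hlim⟩⟩
  rw [riccatiMap, sqrt_transpose_mul_sqrt (outputWeight_posSemidef hR C K)] at hfix
  exact hfix

lemma stabilizing_unique (hγ : 0 < γ) {P₁ P₂ : Matrix m m ℝ}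
    (h₁ : IsStabilizingSolution A B C D R γ K P₁) (h₂ : IsStabilizingSolution A B C D R γ K P₂) :
    P₁ = P₂ := by
  obtain ⟨a1, a2, a3, a4⟩ := (isStabilizingSolution_iff hγ).1 h₁
  obtain ⟨b1, b2, b3, b4⟩ := (isStabilizingSolution_iff hγ).1 h₂
  exact eq_of_stabilizing hγ a1.isHermitian b1.isHermitian a2 b2 a3 b3 a4 b4

end Existence

end MixedDesign

end

theorem theorem4p1 {m d n l : Type*} [Fintype m] [DecidableEq m] [Fintype d] [DecidableEq d]
    [Fintype n] [DecidableEq n] [Fintype l]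
    (A : Matrix m m ℝ) (B : Matrix m d ℝ) (C : Matrix l m ℝ) (D : Matrix m n ℝ)
    (R : Matrix d d ℝ) (hR : R.PosDef) (γ : ℝ) (hγ : 0 < γ)
    (K : Matrix d m ℝ) (hK : K ∈ MixedDesign.feasibleSet A B C D R γ) :
    (∃! P, MixedDesign.IsStabilizingSolution A B C D R γ K P) ∧
    ∀ P, MixedDesign.IsStabilizingSolution A B C D R γ K P → ∀ η : ℝ, 0 < η →
      (η ≤ 1 / (2 * ‖R + B.transpose * MixedDesign.tildeP D γ P * B‖) →
        ∀ K', K' = MixedDesign.npgStep A B D R γ P η K →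
          K' ∈ MixedDesign.feasibleSet A B C D R γ ∧
          MixedDesign.rho (A - B * K') < 1 ∧
          ∃ P', MixedDesign.IsStabilizingSolution A B C D R γ K' P') ∧
      (η ≤ 1 / 2 →
        ∀ K', K' = MixedDesign.gaussNewtonStep A B D R γ P η K →
          K' ∈ MixedDesign.feasibleSet A B C D R γ ∧
          MixedDesign.rho (A - B * K') < 1 ∧
          ∃ P', MixedDesign.IsStabilizingSolution A B C D R γ K' P') := by
  refine ⟨?_, fun P hP η hη => ⟨fun hη' K' hK' => ?_, fun hη' K' hK' => ?_⟩⟩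
  · obtain ⟨P, hP⟩ := MixedDesign.exists_stabilizing_of_mem_feasibleSet hγ hR hK
    exact ⟨P, hP, fun P' hP' => MixedDesign.stabilizing_unique hγ hP' hP⟩
  · have h : K' ∈ MixedDesign.feasibleSet A B C D R γ :=
      hK' ▸ MixedDesign.npgStep_mem_feasibleSet hγ hR hP hη hη'
    exact ⟨h, h.1, MixedDesign.exists_stabilizing_of_mem_feasibleSet hγ hR h⟩
  · have h : K' ∈ MixedDesign.feasibleSet A B C D R γ :=
      hK' ▸ MixedDesign.gaussNewtonStep_mem_feasibleSet hγ hR hP hη hη'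
    exact ⟨h, h.1, MixedDesign.exists_stabilizing_of_mem_feasibleSet hγ hR h⟩
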